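/- **Conventions.** Let $\mathbb S^n=(\mathbb R^{n+1}\smallsetminus\{0\})/\mathbb R_{>0}$, and for $U\subset\mathbb R^{n+1}$ let $\mathbb S(U)$ be the image of $U\smallsetminus\{0\}$. A *mirror polytope* in $\mathbb S^n$ with facets indexed by a finite set $S$ is given by linear forms $\alpha_s$ and vectors $b_s$ ($s\in S$) with $\alpha_s(b_s)=2$ such that $P=\bigcap_s\mathbb S(\{\alpha_s\le 0\})$ is properly convex (the image of a convex cone, with closure containing no two antipodal points) and has non-empty interior, no half-space $\mathbb S(\{\alpha_s\le0\})$ contains the intersection of the others, and for $s\ne t$ the numbers $\alpha_s(b_t),\alpha_t(b_s)$ are both negative or both zero. Its facets are $F_s=P\cap\mathbb S(\ker\alpha_s)$, its reflections are $\sigma_s=\mathrm{Id}-\alpha_s\otimes b_s$, and its Cartan matrix is $(\alpha_s(b_t))_{s,t}$. A path of mirror polytopes is one along which all $\alpha_s$ and $b_s$ vary continuously. A *projective rotation* of angle $\theta\in(0,2\pi)$ is an element of $\mathrm{SL}_{n+1}\mathbb R$ that is the identity on a subspace $H$ of codimension 2 and acts on $\mathbb R^{n+1}/H$ by a map conjugate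 to the rotation matrix of angle $\theta$; a ridge (face of codimension 2) $F_s\cap F_t$ has dihedral angle $\theta\in(0,\pi/2]$ if $\sigma_s\sigma_t$ is a projective rotation of angle $2\theta$. A real square matrix $A$ is *Cartan* if $A_{ii}=2$, $A_{ij}\le0$ for $i\neq j$, and $A_{ij}=0\Leftrightarrow A_{ji}=0$; it is *irreducible* if it is not a direct sum of smaller matrices after reordering the indices; an irreducible Cartan matrix is of *negative type* if there is $y>0$ with $Ay<0$ (in all coordinates), and $Ax\ge0$, $x\ge0$ imply $x=0$. Let $v_1,\dots,v_5\in\mathbb R^4$ be the vertices of a regular 4-simplex with barycentre $0$, let $c=|v_i|$, and for $0<s\le c$ let $Q_s$ be the set of $x\in\mathbb R^4$ with $\langle v_i,x\rangle\ge-c^2/4$ and $\langle v_i,x\rangle\le cs$ for all $i$. Let $F_i$ (opposite to $v_i$) and $F'_i$ be the faces of $Q_s$ where equality holds in the first, respectively the second inequality. $Q_s$ is a *bitruncated 4-simplex* for $c/6<s<3c/8$ and the *rectified 4-simplex* for $s=3c/8$. The *ideal hyperbolic rectified 4-simplex* $R$ is the rectified 4-simplex, viewed in the projective model of $\mathbb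 H^4$ given by the ball in which it is inscribed, with the hyperbolic reflections in its facets. Put $t_3=\frac12\bigl(11+9\sqrt2-3\sqrt{31+22\sqrt2}\bigr)$ and, for $t\in[t_3,1]$ and $p=0,1,2,3$, $$f=\frac{t(t+2)^3(2t+1)^3}{(t^2+t+1)^2(t^2+7t+1)^2},\quad h=2+\frac1t+\frac{t(t+2)^4}{(t^2+t+1)(t^2+7t+1)},\quad g_p=\frac{2t^p(t+2)^p(2t+1)^{3-p}}{(t^2+t+1)(t^2+7t+1)},\quad \overline g_p=\frac{4f}{g_p}.$$ Let $C_t$ be the matrix with rows and columns indexed by $S=\{1',\dots,5',1,\dots,5\}$, diagonal entries $2$, and off-diagonal entries $(C_t)_{i'j'}=-\overline g_{j-i-1}(t)$ for $i<j$ and $-g_{i-j-1}(t)$ for $i>j$; $(C_t)_{ij}=-1/t$ for $i<j$ and $-t$ for $i>j$; $(C_t)_{i'i}=-h(t)$, $(C_t)_{ii'}=-2$, and $(C_t)_{i'j}=(C_t)_{ij'}=0$ for $i\ne j$. **Proposition.** For every $t\in[t_3,1]$ the matrix $C_t$ is an irreducible Cartan matrix of negative type and of rank $5$, and it depends analytically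 on $t\in[t_3,1]$. There are a strictly decreasing analytic function $\alpha\colon[t_3,1]\to\mathbb R$ with $\cos^2\alpha(t)=f(t)$, $\alpha(t_3)=\pi/3$, $\alpha(1)=0$, and a path $[0,\pi/3]\ni\alpha\mapsto P_\alpha$ of mirror polytopes in $\mathbb S^4$ with facets $F'_1,\dots,F'_5,F_1,\dots,F_5$, such that $P_{\alpha(t)}$ has Cartan matrix $C_t$ for every $t\in[t_3,1]$, and: * for every $\alpha\in(0,\pi/3]$, $P_\alpha$ is combinatorially equivalent to a bitruncated 4-simplex, by an isomorphism of face posets that preserves the labels of the facets; * for every $\alpha\in(0,\pi/3]$ and all $i\ne j$, the intersections $F'_i\cap F'_j$ (the filling ridges), $F_i\cap F'_j$ and $F_i\cap F_j$ are ridges of $P_\alpha$, with dihedral angles $\alpha$, $\pi/2$ and $\pi/3$, respectively; * the limit $P_0$ is, up to a linear change of coordinates of $\mathbb R^5$, the ideal hyperbolic rectified 4-simplex $R$: its polytope, its labelled facets and its reflections are those of $R$. -/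

import Mathlib

open Set Real

noncomputable section

/-! ### The projective sphere -/

/-- The vector space `ℝⁿ⁺¹`. -/
abbrev Vec (n : ℕ) : Type := Fin (n + 1) → ℝ

/-- The projective sphere `𝕊ⁿ = (ℝⁿ⁺¹ ∖ {0}) / ℝ_{>0}`. -/
abbrev ProjSphere (n : ℕ) : Type := Module.Ray ℝ (Vec n)

/-- The canonical projection `ℝⁿ⁺¹ ∖ {0} → 𝕊ⁿ`. -/
def toSphere {n : ℕ} (v : {v : Vec n // v ≠ 0}) : ProjSphere n :=
  rayOfNeZero ℝ v.1 v.2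

/-- The projective sphere carries the quotient topology. -/
instance projSphereTopology (n : ℕ) : TopologicalSpace (ProjSphere n) :=
  TopologicalSpace.coinduced toSphere inferInstance

/-- `𝕊(U)`, the image in `𝕊ⁿ` of `U ∖ {0}`, for `U ⊆ ℝⁿ⁺¹`. -/
def sphereImage {n : ℕ} (U : Set (Vec n)) : Set (ProjSphere n) :=
  toSphere '' {v | v.1 ∈ U}

/-- The set of nonzero vectors of `ℝⁿ⁺¹` whose class lies in `A ⊆ 𝕊ⁿ`. -/
def coneOver {n : ℕ} (A : Set (ProjSphere n)) : Set (Vec n) :=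
  Subtype.val '' (toSphere ⁻¹' A)

/-- Convex subsets of `𝕊ⁿ`: the images of convex cones. -/
def IsSphereConvex {n : ℕ} (A : Set (ProjSphere n)) : Prop :=
  ∃ U : ConvexCone ℝ (Vec n), A = sphereImage (U : Set (Vec n))

/-- Properly convex subsets of `𝕊ⁿ`: convex, and the closure contains no pair of antipodal
points. -/
def IsProperlyConvex {n : ℕ} (A : Set (ProjSphere n)) : Prop :=
  IsSphereConvex A ∧ ∀ x ∈ closure A, -x ∉ closure A

/-- The closed half-space `𝕊({v | φ v ≤ 0})`. -/
def halfSphere {n : ℕ} (φ : Module.Dual ℝ (Vec n)) : Set (ProjSphere n) :=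
  sphereImage {v | φ v ≤ 0}

/-- The faces of a polytope `A ⊆ 𝕊ⁿ` (including `∅` and `A`): the intersections of `A` with
the hyperplanes `𝕊(ker φ)` such that `A` lies on one side of it. -/
def IsFace {n : ℕ} (A F : Set (ProjSphere n)) : Prop :=
  ∃ φ : Module.Dual ℝ (Vec n), A ⊆ halfSphere φ ∧ F = A ∩ sphereImage {v | φ v = 0}

/-- A ridge of an `n`-polytope is a face of codimension two: the cone over it spans a subspace
of dimension `(n + 1) - 2`. -/
def IsRidge {n : ℕ} (A F : Set (ProjSphere n)) : Prop :=
  IsFace A F ∧ Module.finrank ℝ (Submodule.span ℝ (coneOver F)) + 2 = n + 1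

/-! ### Mirror polytopes -/

/-- A mirror polytope in `𝕊ⁿ` whose facets are indexed by `S`, presented by linear forms `α_s`
and vectors `b_s`: the polytope is `⋂ₛ 𝕊({α_s ≤ 0})` and the reflections are
`σ_s = Id - α_s ⊗ b_s`. By minimality of the family of half-spaces, `S` indexes the facets of
the polytope without repetition. -/
structure MirrorPolytope (n : ℕ) (S : Type) [Finite S] where
  form : S → Module.Dual ℝ (Vec n)
  vec : S → Vec n
  form_vec : ∀ s, form s (vec s) = 2
  properlyConvex : IsProperlyConvex (⋂ s, halfSphere (form s))
  interior_nonempty : (interior (⋂ s, halfSphere (form s))).Nonempty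
  minimal : ∀ s, ¬ (⋂ t ∈ {t : S | t ≠ s}, halfSphere (form t)) ⊆ halfSphere (form s)
  neg_or_zero : ∀ s t, s ≠ t →
    (form s (vec t) < 0 ∧ form t (vec s) < 0) ∨ (form s (vec t) = 0 ∧ form t (vec s) = 0)

namespace MirrorPolytope

variable {n : ℕ} {S : Type} [Finite S]

/-- The underlying polytope. -/
def carrier (P : MirrorPolytope n S) : Set (ProjSphere n) :=
  ⋂ s, halfSphere (P.form s)

/-- The facet indexed by `s`. -/
def facet (P : MirrorPolytope n S) (s : S) : Set (ProjSphere n) :=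
  P.carrier ∩ sphereImage {v | P.form s v = 0}

theorem isFace_facet (P : MirrorPolytope n S) (s : S) : IsFace P.carrier (P.facet s) :=
  ⟨P.form s, iInter_subset _ s, rfl⟩

/-- The projective reflection `σ_s(v) = v - α_s(v) b_s`. -/
def refl (P : MirrorPolytope n S) (s : S) : Vec n ≃ₗ[ℝ] Vec n :=
  Module.reflection (P.form_vec s)

/-- The Cartan matrix `(α_s(b_t))_{s,t}`. -/
def cartan (P : MirrorPolytope n S) : Matrix S S ℝ :=
  Matrix.of fun s t => P.form s (P.vec t)

/-- Mirror polytopes are topologised by their linear forms and vectors. -/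
instance topology : TopologicalSpace (MirrorPolytope n S) :=
  TopologicalSpace.induced
    (fun P : MirrorPolytope n S => ((fun s v => P.form s v : S → Vec n → ℝ), P.vec)) inferInstance

end MirrorPolytope

/-- A projective rotation of angle `θ`: an element of `SL_{n+1}(ℝ)` that is the identity on a
subspace `H` of codimension `2` and that induces on `ℝⁿ⁺¹ / H` a map conjugate to the rotation
matrix of angle `θ`, where `0 < θ < 2π`. -/
def IsProjRotation {n : ℕ} (g : Vec n →ₗ[ℝ] Vec n) (θ : ℝ) : Prop :=
  0 < θ ∧ θ < 2 * π ∧ LinearMap.det g = 1 ∧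
    ∃ (H : Submodule ℝ (Vec n)) (hH : H ≤ H.comap g), (∀ v ∈ H, g v = v) ∧
      ∃ e : Module.Basis (Fin 2) ℝ (Vec n ⧸ H),
        LinearMap.toMatrix e e (H.mapQ H g hH) = !![cos θ, -sin θ; sin θ, cos θ]

/-- `F_s ∩ F_t` is a ridge of the mirror polytope `P`, with dihedral angle `θ`: either
`θ ∈ (0, π/2]` and `σ_s σ_t` is a projective rotation of angle `2θ`, or `θ = 0` and `σ_s σ_t`
is not a projective rotation. -/
def HasDihedralAngle {n : ℕ} {S : Type} [Finite S] (P : MirrorPolytope n S) (s t : S) (θ : ℝ) :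
    Prop :=
  IsRidge P.carrier (P.facet s ∩ P.facet t) ∧
    ((0 < θ ∧ θ ≤ π / 2 ∧
        IsProjRotation ((P.refl s : Vec n →ₗ[ℝ] Vec n) ∘ₗ (P.refl t : Vec n →ₗ[ℝ] Vec n)) (2 * θ)) ∨
      (θ = 0 ∧ ∀ η, ¬ IsProjRotation
        ((P.refl s : Vec n →ₗ[ℝ] Vec n) ∘ₗ (P.refl t : Vec n →ₗ[ℝ] Vec n)) η))

/-! ### Cartan matrices -/

/-- Cartan matrices, in the sense of Vinberg. -/
def IsCartanMatrix {S : Type} (A : Matrix S S ℝ) : Prop :=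
  (∀ i, A i i = 2) ∧ (∀ i j, i ≠ j → A i j ≤ 0) ∧ (∀ i j, i ≠ j → (A i j = 0 ↔ A j i = 0))

/-- A matrix is indecomposable if it is not, after a reordering of the indices, a direct sum of
two smaller matrices. -/
def IsIndecomposable {S : Type} (A : Matrix S S ℝ) : Prop :=
  ¬ ∃ T : Set S, T.Nonempty ∧ Tᶜ.Nonempty ∧ ∀ i ∈ T, ∀ j ∈ Tᶜ, A i j = 0 ∧ A j i = 0

/-- Negative type: there is a vector `y > 0` with `A y < 0`, and `A x ≥ 0`, `x ≥ 0` imply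
`x = 0`; here `<` and `>` are meant in every coordinate. -/
def IsNegativeType {S : Type} [Fintype S] (A : Matrix S S ℝ) : Prop :=
  (∃ y : S → ℝ, (∀ i, 0 < y i) ∧ ∀ i, A.mulVec y i < 0) ∧
    ∀ x : S → ℝ, (∀ i, 0 ≤ A.mulVec x i) → (∀ i, 0 ≤ x i) → x = 0

/-! ### The rectified and the bitruncated 4-simplex -/

/-- The index set of the facets: `Sum.inl i` stands for `F'_i`, and `Sum.inr i` for `F_i`. -/
abbrev FacetIdx : Type := Fin 5 ⊕ Fin 5

/-- Euclidean 4-space. -/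
abbrev E4 : Type := EuclideanSpace ℝ (Fin 4)

/-- `v₁, …, v₅` are the vertices of a regular 4-simplex in `ℝ⁴` with barycentre the origin. -/
def IsRegularSimplex (v : Fin 5 → E4) : Prop :=
  ∑ i, v i = 0 ∧ ∃ l : ℝ, 0 < l ∧ ∀ i j, i ≠ j → dist (v i) (v j) = l

/-- The half-spaces `H'_i` and `H_i`. The boundary of `H'_i` passes through `(s / |v_i|) v_i` and
is orthogonal to `v_i`. The boundary of `H_i` contains the vertices `v_j`, `j ≠ i`: for a regular
simplex with barycentre `0` one has `⟪v_i, v_j⟫ = -|v_i|² / 4`. -/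
def cutHalfSpace (v : Fin 5 → E4) (s : ℝ) : FacetIdx → Set E4
  | Sum.inl i => {x | inner ℝ (v i) x ≤ ‖v i‖ * s}
  | Sum.inr i => {x | -(‖v i‖ ^ 2 / 4) ≤ inner ℝ (v i) x}

/-- The boundaries of the half-spaces `H'_i` and `H_i`. -/
def cutHyperplane (v : Fin 5 → E4) (s : ℝ) : FacetIdx → Set E4
  | Sum.inl i => {x | inner ℝ (v i) x = ‖v i‖ * s}
  | Sum.inr i => {x | inner ℝ (v i) x = -(‖v i‖ ^ 2 / 4)}

/-- The polytope `Q_s = H₁ ∩ ⋯ ∩ H₅ ∩ H'₁ ∩ ⋯ ∩ H'₅`. Let `c = |v_i|`. In barycentric coordinates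
`x = ∑ λ_i v_i`, it is given by `0 ≤ λ_i ≤ (4 s / c + 1) / 5`. So it is the bitruncated 4-simplex
for `c / 6 < s < 3 c / 8` (that is, when the upper bound lies strictly between `1 / 3` and
`1 / 2`), and the rectified 4-simplex, the convex hull of the midpoints of the edges, for
`s = 3 c / 8`. -/
def cutSimplex (v : Fin 5 → E4) (s : ℝ) : Set E4 :=
  ⋂ k, cutHalfSpace v s k

/-- The facets `F'_i` and `F_i` of `Q_s`. -/
def cutFacet (v : Fin 5 → E4) (s : ℝ) (k : FacetIdx) : Set E4 :=
  cutSimplex v s ∩ cutHyperplane v s k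

/-- The mirror polytope `P` is combinatorially equivalent to `Q_s`, by an isomorphism of face
posets that matches the facets with the same labels. -/
def CombEquivCutSimplex (P : MirrorPolytope 4 FacetIdx) (v : Fin 5 → E4) (s : ℝ) : Prop :=
  ∃ e : {F : Set (ProjSphere 4) // IsFace P.carrier F} ≃o
      {B : Set E4 // IsExposed ℝ (cutSimplex v s) B},
    ∀ k, (e ⟨P.facet k, P.isFace_facet k⟩ : Set E4) = cutFacet v s k

/-- The mirror polytope `P` has the combinatorics of a bitruncated 4-simplex (for every choice of
the regular simplex and of the truncation parameter), with facets labelled accordingly. -/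
def IsCombBitruncatedSimplex (P : MirrorPolytope 4 FacetIdx) : Prop :=
  ∀ v : Fin 5 → E4, IsRegularSimplex v →
    ∀ s : ℝ, ‖v 0‖ / 6 < s → s < 3 * ‖v 0‖ / 8 → CombEquivCutSimplex P v s

/-- The bilinear form on `ℝ⁴ × ℝ` whose negative cone is the cone over the open ball
`{(x, 1) | |x| < r}`, the projective model of hyperbolic 4-space. -/
def lorentz (r : ℝ) (p q : E4 × ℝ) : ℝ :=
  inner ℝ p.1 q.1 - r ^ 2 * (p.2 * q.2)

/-- The mirror polytope `P` is the ideal hyperbolic rectified 4-simplex: in suitable linear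
coordinates `ℝ⁵ ≅ ℝ⁴ × ℝ`, its polytope is the Euclidean rectified 4-simplex placed at height `1`,
facet by facet, and its reflections are hyperbolic reflections, that is, they are isometries of the
projective model of hyperbolic space in the ball in which the rectified simplex is inscribed. -/
def IsIdealHyperbolicRectifiedSimplex (P : MirrorPolytope 4 FacetIdx) : Prop :=
  ∀ v : Fin 5 → E4, IsRegularSimplex v →
    ∃ r : ℝ, 0 < r ∧ (cutSimplex v (3 * ‖v 0‖ / 8)).extremePoints ℝ ⊆ Metric.sphere 0 r ∧
      ∃ g : Vec 4 ≃ₗ[ℝ] E4 × ℝ,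
        P.carrier = sphereImage {w | ∃ x ∈ cutSimplex v (3 * ‖v 0‖ / 8), g w = (x, 1)} ∧
        (∀ k, P.facet k = sphereImage {w | ∃ x ∈ cutFacet v (3 * ‖v 0‖ / 8) k, g w = (x, 1)}) ∧
        ∀ k w w', lorentz r (g (P.refl k w)) (g (P.refl k w')) = lorentz r (g w) (g w')

/-! ### The family of Cartan matrices -/

/-- The left end of the parameter interval. -/
def tThree : ℝ := (11 + 9 * √2 - 3 * √(31 + 22 * √2)) / 2

def fFun (t : ℝ) : ℝ :=
  t * (t + 2) ^ 3 * (2 * t + 1) ^ 3 / ((t ^ 2 + t + 1) ^ 2 * (t ^ 2 + 7 * t + 1) ^ 2)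

def hFun (t : ℝ) : ℝ :=
  2 + 1 / t + t * (t + 2) ^ 4 / ((t ^ 2 + t + 1) * (t ^ 2 + 7 * t + 1))

/-- The functions `g_p`, for `p = 0, 1, 2, 3`. -/
def gFun (p : ℕ) (t : ℝ) : ℝ :=
  2 * t ^ p * (t + 2) ^ p * (2 * t + 1) ^ (3 - p) / ((t ^ 2 + t + 1) * (t ^ 2 + 7 * t + 1))

/-- The functions `4 f / g_p`, for `p = 0, 1, 2, 3`. -/
def gBarFun (p : ℕ) (t : ℝ) : ℝ := 4 * fFun t / gFun p t

/-- The 10×10 matrix `C_t`, with rows and columns ordered `1', …, 5', 1, …, 5`. -/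
def cMatrix (t : ℝ) : Matrix FacetIdx FacetIdx ℝ :=
  Matrix.fromBlocks
    !![2, -gBarFun 0 t, -gBarFun 1 t, -gBarFun 2 t, -gBarFun 3 t;
      -gFun 0 t, 2, -gBarFun 0 t, -gBarFun 1 t, -gBarFun 2 t;
      -gFun 1 t, -gFun 0 t, 2, -gBarFun 0 t, -gBarFun 1 t;
      -gFun 2 t, -gFun 1 t, -gFun 0 t, 2, -gBarFun 0 t;
      -gFun 3 t, -gFun 2 t, -gFun 1 t, -gFun 0 t, 2]
    (Matrix.diagonal fun _ => -hFun t)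
    (Matrix.diagonal fun _ => -2)
    !![2, -(1 / t), -(1 / t), -(1 / t), -(1 / t);
      -t, 2, -(1 / t), -(1 / t), -(1 / t);
      -t, -t, 2, -(1 / t), -(1 / t);
      -t, -t, -t, 2, -(1 / t);
      -t, -t, -t, -t, 2]

end

/-!
Take coordinates on `ℝ⁵` in which the forms of the facets `F_i` are `y ↦ -y_i`. The forms of the
`F'_i` are then half the rows of the upper left block `M` of `C_t`, so the polytope is the
projectivised cone `{y ≥ 0, M y ≤ 0}`. The product of the two diagonal blocks of `C_t` is the
scalar matrix `2h`; this provides the vectors `b_s` in `ℝ⁵`, whence the rank `5`.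

Which facets of such a cone meet in a common point is decided by signs alone: the off-diagonal
entries of `M` and its `3 × 3` principal minors are negative, its `2 × 2` principal minors positive.
The Euclidean bitruncated simplex is a section of the cone of a symmetric matrix with the same
signs, and a face is determined by the facets that contain it, so the face posets agree.

As a function of `t + 1 / t`, which decreases on `(0, 1]`, `f` is strictly decreasing. The angle
stays analytic at `t = 1`, where `cos² α = 1`, because `1 - f` is `(1 - t)²` times a positive
function. At `t = 1` the `2 × 2` minors vanish, the matrix is the symmetric one of the rectified
simplex, and the reflections preserve the Lorentz form of the sphere around it.
-/
noncomputable section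

/-! ### Faces of polyhedra -/

section Polyhedron

variable {E κ : Type*}

section Module

variable [AddCommGroup E] [Module ℝ E]

/-- The polyhedron cut out by the inequalities `ℓ k x ≤ c k`; for `c = 0` it is a cone. -/
def polyhedron (ℓ : κ → Module.Dual ℝ E) (c : κ → ℝ) : Set E := {x | ∀ k, ℓ k x ≤ c k}

/-- The inequalities of `polyhedron ℓ c` that are equalities at `x`. -/
def activeSet (ℓ : κ → Module.Dual ℝ E) (c : κ → ℝ) (x : E) : Set κ := {k | ℓ k x = c k}

variable {ℓ : κ → Module.Dual ℝ E} {c : κ → ℝ} {x y v : E}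

theorem mem_polyhedron_zero : x ∈ polyhedron ℓ 0 ↔ ∀ k, ℓ k x ≤ 0 := Iff.rfl

theorem mem_activeSet {k : κ} : k ∈ activeSet ℓ c x ↔ ℓ k x = c k := Iff.rfl

theorem mem_activeSet_zero {k : κ} : k ∈ activeSet ℓ 0 x ↔ ℓ k x = 0 := Iff.rfl

@[simp] theorem activeSet_zero_zero : activeSet ℓ 0 0 = univ := by simp [activeSet]

theorem lt_of_notMem_activeSet (hx : x ∈ polyhedron ℓ c) {k : κ} (hk : k ∉ activeSet ℓ c x) :
    ℓ k x < c k :=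
  (hx k).lt_of_ne hk

theorem smul_mem_polyhedron_zero {r : ℝ} (hr : 0 ≤ r) (hx : x ∈ polyhedron ℓ 0) :
    r • x ∈ polyhedron ℓ 0 := fun k => by
  simpa using mul_nonpos_of_nonneg_of_nonpos hr (hx k)

theorem add_mem_polyhedron_zero (hx : x ∈ polyhedron ℓ 0) (hy : y ∈ polyhedron ℓ 0) :
    x + y ∈ polyhedron ℓ 0 := fun k => by
  simpa using add_nonpos (hx k) (hy k)

theorem activeSet_smul {r : ℝ} (hr : r ≠ 0) : activeSet ℓ 0 (r • x) = activeSet ℓ 0 x := by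
  ext k
  simp [mem_activeSet_zero, hr]

theorem half_smul_add_mem_polyhedron (hx : x ∈ polyhedron ℓ c) (hy : y ∈ polyhedron ℓ c) :
    (1 / 2 : ℝ) • (x + y) ∈ polyhedron ℓ c := fun k => by
  simp only [map_smul, map_add, smul_eq_mul]
  linarith [hx k, hy k]

theorem activeSet_half_smul_add (hx : x ∈ polyhedron ℓ c) (hy : y ∈ polyhedron ℓ c) :
    activeSet ℓ c ((1 / 2 : ℝ) • (x + y)) ⊆ activeSet ℓ c x ∩ activeSet ℓ c y := by
  intro k hk
  simp only [mem_activeSet, map_smul, map_add, smul_eq_mul] at hk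
  exact ⟨le_antisymm (hx k) (by linarith [hy k]), le_antisymm (hy k) (by linarith [hx k])⟩

theorem exists_pos_add_smul_mem_polyhedron [Finite κ] (hx : x ∈ polyhedron ℓ c)
    (hv : ∀ k ∈ activeSet ℓ c x, ℓ k v ≤ 0) : ∃ ε : ℝ, 0 < ε ∧ x + ε • v ∈ polyhedron ℓ c := by
  have eventually_le : ∀ k, ∀ᶠ ε in nhdsWithin (0 : ℝ) (Ioi 0), ℓ k (x + ε • v) ≤ c k := by
    intro k
    simp only [map_add, map_smul, smul_eq_mul]
    by_cases hk : k ∈ activeSet ℓ c x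
    · filter_upwards [self_mem_nhdsWithin] with ε hε
      rw [mem_activeSet.1 hk, add_le_iff_nonpos_right]
      exact mul_nonpos_of_nonneg_of_nonpos (le_of_lt hε) (hv k hk)
    · have hcont : Continuous fun ε : ℝ => ℓ k x + ε * ℓ k v := by fun_prop
      have hlim := (hcont.tendsto 0).mono_left (nhdsWithin_le_nhds (s := Ioi 0))
      rw [zero_mul, add_zero] at hlim
      exact (hlim.eventually_lt_const (lt_of_notMem_activeSet hx hk)).mono fun _ => le_of_lt
  obtain ⟨ε, hmem, hε⟩ :=
    ((Filter.eventually_all.2 eventually_le).and self_mem_nhdsWithin).exists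
  exact ⟨ε, hε, hmem⟩

theorem eq_zero_of_mem_extremePoints_polyhedron [Finite κ]
    (hx : x ∈ (polyhedron ℓ c).extremePoints ℝ) (hv : ∀ k ∈ activeSet ℓ c x, ℓ k v = 0) :
    v = 0 := by
  obtain ⟨hxA, hext⟩ := mem_extremePoints_iff_left.1 hx
  obtain ⟨ε, hε, hmem⟩ := exists_pos_add_smul_mem_polyhedron hxA fun k hk => (hv k hk).le
  obtain ⟨δ, hδ, hmem'⟩ := exists_pos_add_smul_mem_polyhedron (v := -v) hxA fun k hk => by
    simp [hv k hk]
  have heq : x + ε • v = x := hext _ hmem _ hmem'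
    ⟨δ / (ε + δ), ε / (ε + δ), by positivity, by positivity, by field_simp; ring, by
      match_scalars
      · field_simp
        ring
      · field_simp
        ring⟩
  simpa [hε.ne'] using heq

/-- Otherwise the segment from `x` to `x₀` could be prolonged inside the polyhedron beyond `x₀`,
where `l` would exceed `m`. -/
theorem eq_of_activeSet_subset [Finite κ] {l : Module.Dual ℝ E} {m : ℝ} {x₀ : E}
    (hl : ∀ x ∈ polyhedron ℓ c, l x ≤ m) (hx₀ : x₀ ∈ polyhedron ℓ c) (hm : l x₀ = m)
    (hx : x ∈ polyhedron ℓ c) (hsub : activeSet ℓ c x₀ ⊆ activeSet ℓ c x) : l x = m := by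
  obtain ⟨ε, hε, hmem⟩ := exists_pos_add_smul_mem_polyhedron (v := x₀ - x) hx₀ fun k hk => by
    rw [map_sub, mem_activeSet.1 hk, mem_activeSet.1 (hsub hk), sub_self]
  have hle := hl _ hmem
  rw [map_add, map_smul, map_sub, hm, smul_eq_mul, add_le_iff_nonpos_right] at hle
  exact le_antisymm (hl x hx) (sub_nonpos.1 (nonpos_of_mul_nonpos_right hle hε))

theorem exists_forall_act_subset {X : Type*} [Finite κ] {F : Set X} (act : X → Set κ)
    (hF : F.Nonempty) (h : ∀ x ∈ F, ∀ y ∈ F, ∃ z ∈ F, act z ⊆ act x ∩ act y) :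
    ∃ x₀ ∈ F, ∀ x ∈ F, act x₀ ⊆ act x := by
  obtain ⟨_, ⟨x₀, hx₀, rfl⟩, hmin⟩ := (Set.toFinite (act '' F)).exists_minimal (hF.image act)
  refine ⟨x₀, hx₀, fun x hx => ?_⟩
  obtain ⟨z, hz, hzs⟩ := h x₀ hx₀ x hx
  exact (hmin (mem_image_of_mem _ hz) (hzs.trans inter_subset_left)).trans
    (hzs.trans inter_subset_right)

theorem exists_eq_iff_activeSet_subset [Finite κ] {l : Module.Dual ℝ E} {m : ℝ}
    (hl : ∀ x ∈ polyhedron ℓ c, l x ≤ m) (hne : ∃ x ∈ polyhedron ℓ c, l x = m) :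
    ∃ x₀ ∈ polyhedron ℓ c, l x₀ = m ∧
      ∀ x ∈ polyhedron ℓ c, l x = m ↔ activeSet ℓ c x₀ ⊆ activeSet ℓ c x := by
  obtain ⟨x₀, ⟨hx₀, hm⟩, hmin⟩ := exists_forall_act_subset (F := {x ∈ polyhedron ℓ c | l x = m})
    (activeSet ℓ c) hne fun x hx y hy =>
      ⟨(1 / 2 : ℝ) • (x + y), ⟨half_smul_add_mem_polyhedron hx.1 hy.1, by
        rw [map_smul, map_add, hx.2, hy.2, smul_eq_mul]; ring⟩, activeSet_half_smul_add hx.1 hy.1⟩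
  exact ⟨x₀, hx₀, hm, fun x hx =>
    ⟨fun h => hmin x ⟨hx, h⟩, eq_of_activeSet_subset hl hx₀ hm hx⟩⟩

theorem sum_eq_sum_iff_subset_activeSet {J : Finset κ} (hx : x ∈ polyhedron ℓ c) :
    ∑ k ∈ J, ℓ k x = ∑ k ∈ J, c k ↔ (J : Set κ) ⊆ activeSet ℓ c x :=
  Finset.sum_eq_sum_iff_of_le fun k _ => hx k

theorem exists_activeSet_eq [Finite κ] {J : Set κ}
    (h : ∀ p ∉ J, ∃ y ∈ polyhedron ℓ 0, J ⊆ activeSet ℓ 0 y ∧ p ∉ activeSet ℓ 0 y) :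
    ∃ y ∈ polyhedron ℓ 0, activeSet ℓ 0 y = J := by
  classical
  have := Fintype.ofFinite κ
  choose! y hmem hsub hnot using h
  have hle : ∀ q, ∀ p ∈ Finset.univ.filter (· ∉ J), ℓ q (y p) ≤ 0 := fun q p hp =>
    hmem p (Finset.mem_filter.1 hp).2 q
  refine ⟨∑ p with p ∉ J, y p, fun q => ?_, Subset.antisymm (fun q hq => ?_) fun q hq => ?_⟩
  · rw [map_sum]
    exact Finset.sum_nonpos (hle q)
  · by_contra hqJ
    rw [mem_activeSet_zero, map_sum, Finset.sum_eq_zero_iff_of_nonpos (hle q)] at hq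
    exact hnot q hqJ (hq q (by simpa using hqJ))
  · rw [mem_activeSet_zero, map_sum]
    exact Finset.sum_eq_zero fun p hp => hsub p (Finset.mem_filter.1 hp).2 hq

end Module

/-- The faces of a polytope whose points have active sets `act x`: the empty set, and the sets of
points at which all constraints active at some given point are active. -/
def IsActiveFace {X : Type*} (A : Set X) (act : X → Set κ) (F : Set X) : Prop :=
  F = ∅ ∨ ∃ x₀ ∈ A, F = {x ∈ A | act x₀ ⊆ act x}

section Exposed

variable [NormedAddCommGroup E] [NormedSpace ℝ E] [Finite κ]

theorem isExposed_setOf_activeSet_subset (ℓ : κ → StrongDual ℝ E) (c : κ → ℝ) {x₀ : E}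
    (hx₀ : x₀ ∈ polyhedron (fun k => (ℓ k).toLinearMap) c) :
    IsExposed ℝ (polyhedron (fun k => (ℓ k).toLinearMap) c)
      {x ∈ polyhedron (fun k => (ℓ k).toLinearMap) c |
        activeSet (fun k => (ℓ k).toLinearMap) c x₀ ⊆
          activeSet (fun k => (ℓ k).toLinearMap) c x} := by
  classical
  have := Fintype.ofFinite κ
  have hJ : ((Finset.univ.filter fun k => ℓ k x₀ = c k : Finset κ) : Set κ) =
      activeSet (fun k => (ℓ k).toLinearMap) c x₀ := by
    ext k
    simp [mem_activeSet]
  have hmax : ∀ x ∈ polyhedron (fun k => (ℓ k).toLinearMap) c,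
      activeSet (fun k => (ℓ k).toLinearMap) c x₀ ⊆ activeSet _ c x ↔
        ∑ k with ℓ k x₀ = c k, ℓ k x = ∑ k with ℓ k x₀ = c k, c k := fun x hx =>
    hJ ▸ (sum_eq_sum_iff_subset_activeSet hx).symm
  refine fun _ => ⟨∑ k with ℓ k x₀ = c k, ℓ k, ext fun x => and_congr_right fun hx => ?_⟩
  simp only [sum_apply, hmax x hx]
  constructor
  · intro h y hy
    exact h ▸ Finset.sum_le_sum fun k _ => hy k
  · intro h
    exact le_antisymm (Finset.sum_le_sum fun k _ => hx k)
      (((hmax x₀ hx₀).1 Subset.rfl).symm.trans_le (h x₀ hx₀))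

theorem isExposed_polyhedron_iff (ℓ : κ → StrongDual ℝ E) (c : κ → ℝ) (B : Set E) :
    IsExposed ℝ (polyhedron (fun k => (ℓ k).toLinearMap) c) B ↔
      IsActiveFace (polyhedron (fun k => (ℓ k).toLinearMap) c)
        (activeSet (fun k => (ℓ k).toLinearMap) c) B := by
  constructor
  · intro hexp
    rcases B.eq_empty_or_nonempty with rfl | ⟨b, hb⟩
    · exact Or.inl rfl
    obtain ⟨l, rfl⟩ := hexp ⟨b, hb⟩
    obtain ⟨x₀, hx₀, -, hiff⟩ := exists_eq_iff_activeSet_subset (l := l.toLinearMap) hb.2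
      ⟨b, hb.1, rfl⟩
    refine Or.inr ⟨x₀, hx₀, ext fun x => and_congr_right fun hx => (Iff.trans ?_ (hiff x hx))⟩
    exact ⟨fun h => le_antisymm (hb.2 x hx) (h b hb.1), fun h y hy => (hb.2 y hy).trans h.ge⟩
  · rintro (rfl | ⟨x₀, hx₀, rfl⟩)
    · exact isExposed_empty
    · exact isExposed_setOf_activeSet_subset ℓ c hx₀

end Exposed

end Polyhedron

section ActiveFace

variable {X Y κ : Type*} {A : Set X} {B : Set Y} {actA : X → Set κ} {actB : Y → Set κ}

/-- The points of `B` that have the same active set as some point of `F`. -/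
def transferFace (actA : X → Set κ) (B : Set Y) (actB : Y → Set κ) (F : Set X) : Set Y :=
  {y ∈ B | ∃ x ∈ F, actA x = actB y}

theorem transferFace_setOf (h : actA '' A = actB '' B) (p : Set κ → Prop) :
    transferFace actA B actB {x ∈ A | p (actA x)} = {y ∈ B | p (actB y)} := by
  ext y
  constructor
  · rintro ⟨hy, x, ⟨_, hx⟩, e⟩
    exact ⟨hy, e ▸ hx⟩
  · rintro ⟨hy, hp⟩
    obtain ⟨x, hx, e⟩ : actB y ∈ actA '' A := h ▸ mem_image_of_mem _ hy
    exact ⟨hy, x, ⟨hx, e ▸ hp⟩, e⟩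

theorem IsActiveFace.transferFace (h : actA '' A = actB '' B) {F : Set X}
    (hF : IsActiveFace A actA F) : IsActiveFace B actB (transferFace actA B actB F) := by
  rcases hF with rfl | ⟨x₀, hx₀, rfl⟩
  · left; ext; simp [_root_.transferFace]
  · obtain ⟨y₀, hy₀, e⟩ : actA x₀ ∈ actB '' B := h ▸ mem_image_of_mem _ hx₀
    exact Or.inr ⟨y₀, hy₀, by rw [transferFace_setOf h (fun J => actA x₀ ⊆ J), e]⟩

theorem IsActiveFace.exists_eq_setOf {F : Set X} (hF : IsActiveFace A actA F) :
    ∃ p : Set κ → Prop, F = {x ∈ A | p (actA x)} := by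
  rcases hF with rfl | ⟨x₀, _, rfl⟩
  · exact ⟨fun _ => False, by simp⟩
  · exact ⟨fun J => actA x₀ ⊆ J, rfl⟩

theorem transferFace_transferFace (h : actA '' A = actB '' B) {F : Set X}
    (hF : IsActiveFace A actA F) :
    transferFace actB A actA (transferFace actA B actB F) = F := by
  obtain ⟨p, rfl⟩ := hF.exists_eq_setOf
  rw [transferFace_setOf h, transferFace_setOf h.symm]

theorem transferFace_mono {F G : Set X} (h : F ⊆ G) :
    transferFace actA B actB F ⊆ transferFace actA B actB G :=
  fun _ ⟨hy, x, hx, e⟩ => ⟨hy, x, h hx, e⟩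

/-- Polytopes with the same active sets have isomorphic face posets. The predicates `PA` and `PB`
single out the faces in whichever way the two polytopes define them. -/
def activeFaceOrderIso (h : actA '' A = actB '' B) {PA : Set X → Prop} {PB : Set Y → Prop}
    (hA : ∀ F, PA F ↔ IsActiveFace A actA F) (hB : ∀ F, PB F ↔ IsActiveFace B actB F) :
    {F : Set X // PA F} ≃o {F : Set Y // PB F} where
  toFun F := ⟨transferFace actA B actB F.1, (hB _).2 (((hA _).1 F.2).transferFace h)⟩
  invFun F := ⟨transferFace actB A actA F.1, (hA _).2 (((hB _).1 F.2).transferFace h.symm)⟩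
  left_inv F := Subtype.ext (transferFace_transferFace h ((hA _).1 F.2))
  right_inv F := Subtype.ext (transferFace_transferFace h.symm ((hB _).1 F.2))
  map_rel_iff' {F G} := by
    refine ⟨fun hle => ?_, fun hle => transferFace_mono hle⟩
    have hle' : transferFace actA B actB F.1 ⊆ transferFace actA B actB G.1 := hle
    rw [← Subtype.coe_le_coe, ← transferFace_transferFace h ((hA _).1 F.2),
      ← transferFace_transferFace h ((hA _).1 G.2)]
    exact transferFace_mono hle'

end ActiveFace

/-! ### Mirror polytopes and their cones -/

section ProjSphere

variable {n : ℕ}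

theorem toSphere_surjective : Function.Surjective (toSphere (n := n)) := fun x => by
  induction x using Module.Ray.ind with
  | h v hv => exact ⟨⟨v, hv⟩, rfl⟩

theorem toSphere_mem_sphereImage {U : Set (Vec n)} (hU : ∀ c : ℝ, 0 < c → ∀ v ∈ U, c • v ∈ U)
    (v : {v : Vec n // v ≠ 0}) : toSphere v ∈ sphereImage U ↔ v.1 ∈ U := by
  constructor
  · rintro ⟨w, hw, h⟩
    obtain ⟨c, hc, hcv⟩ := ((ray_eq_iff w.2 v.2).1 h).exists_pos_left w.2 v.2
    exact hcv ▸ hU c hc _ hw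
  · exact fun h => ⟨v, h, rfl⟩

theorem toSphere_mem_halfSphere (φ : Module.Dual ℝ (Vec n)) (v : {v : Vec n // v ≠ 0}) :
    toSphere v ∈ halfSphere φ ↔ φ v.1 ≤ 0 := by
  refine toSphere_mem_sphereImage (fun c hc w hw => ?_) v
  simpa using mul_nonpos_of_nonneg_of_nonpos hc.le hw

theorem toSphere_mem_kerImage (φ : Module.Dual ℝ (Vec n)) (v : {v : Vec n // v ≠ 0}) :
    toSphere v ∈ sphereImage {w | φ w = 0} ↔ φ v.1 = 0 :=
  toSphere_mem_sphereImage (fun c _ w hw => by simp_all) v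

theorem neg_toSphere (v : {v : Vec n // v ≠ 0}) :
    -toSphere v = toSphere ⟨-v.1, neg_ne_zero.2 v.2⟩ :=
  neg_rayOfNeZero ℝ v.1 v.2

theorem isClosed_halfSphere (φ : Module.Dual ℝ (Vec n)) : IsClosed (halfSphere φ) := by
  rw [isClosed_coinduced, show toSphere ⁻¹' halfSphere φ = {v | φ v.1 ≤ 0} from
    ext (toSphere_mem_halfSphere φ)]
  exact isClosed_le (φ.continuous_of_finiteDimensional.comp continuous_subtype_val)
    continuous_const

theorem mem_coneOver {A : Set (ProjSphere n)} {v : Vec n} :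
    v ∈ coneOver A ↔ ∃ hv : v ≠ 0, toSphere ⟨v, hv⟩ ∈ A := by
  simp [coneOver]

section Forms

variable {S : Type} {form : S → Module.Dual ℝ (Vec n)}

theorem toSphere_mem_iInter_halfSphere {v : {v : Vec n // v ≠ 0}} :
    toSphere v ∈ ⋂ s, halfSphere (form s) ↔ v.1 ∈ polyhedron form 0 := by
  simp [toSphere_mem_halfSphere, mem_polyhedron_zero]

theorem isProperlyConvex_iInter_halfSphere (h : ∀ v, (∀ s, form s v = 0) → v = 0) :
    IsProperlyConvex (⋂ s, halfSphere (form s)) := by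
  refine ⟨⟨⟨polyhedron form 0, fun _ hc _ hv => smul_mem_polyhedron_zero (le_of_lt hc) hv,
    fun _ hv _ hw => add_mem_polyhedron_zero hv hw⟩, ext fun x => ?_⟩, ?_⟩
  · obtain ⟨v, rfl⟩ := toSphere_surjective x
    rw [toSphere_mem_iInter_halfSphere]
    exact (toSphere_mem_sphereImage
      (fun _ hc _ hw => smul_mem_polyhedron_zero (le_of_lt hc) hw) v).symm
  · rw [(isClosed_iInter fun s => isClosed_halfSphere (form s)).closure_eq]
    intro x hx hx'
    obtain ⟨v, rfl⟩ := toSphere_surjective x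
    rw [neg_toSphere, toSphere_mem_iInter_halfSphere] at hx'
    rw [toSphere_mem_iInter_halfSphere] at hx
    exact v.2 (h v.1 fun s => le_antisymm (hx s) (by simpa using hx' s))

theorem interior_iInter_halfSphere_nonempty [Finite S] {y : Vec n} (hy0 : y ≠ 0)
    (hy : ∀ s, form s y < 0) : (interior (⋂ s, halfSphere (form s))).Nonempty := by
  have hpre : toSphere ⁻¹' sphereImage {v : Vec n | ∀ s, form s v < 0} =
      {v : {v : Vec n // v ≠ 0} | ∀ s, form s v.1 < 0} :=
    ext fun v => toSphere_mem_sphereImage (U := {v | ∀ s, form s v < 0})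
      (fun c hc w hw s => by simpa using mul_neg_of_pos_of_neg hc (hw s)) v
  refine ⟨toSphere ⟨y, hy0⟩, mem_interior.2 ⟨sphereImage {v | ∀ s, form s v < 0}, ?_, ?_, ?_⟩⟩
  · rintro _ ⟨v, hv, rfl⟩
    exact toSphere_mem_iInter_halfSphere.2 fun s => (hv s).le
  · rw [isOpen_coinduced, hpre, ofPred_forall]
    exact isOpen_iInter_of_finite fun s => isOpen_lt
      ((form s).continuous_of_finiteDimensional.comp continuous_subtype_val) continuous_const
  · exact mem_image_of_mem _ (show y ∈ {v : Vec n | ∀ s, form s v < 0} from hy)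

end Forms

end ProjSphere

namespace MirrorPolytope

variable {n : ℕ} {S : Type} [Finite S]

/-- The mirror polytope presented by linear forms and vectors with the sign pattern of a Cartan
matrix, for forms that separate points and are simultaneously negative somewhere. The forms are
then irredundant, since `vec s` violates the inequality of `s` only. -/
def ofCartan (form : S → Module.Dual ℝ (Vec n)) (vec : S → Vec n)
    (form_vec : ∀ s, form s (vec s) = 2)
    (neg_or_zero : ∀ s t, s ≠ t →
      (form s (vec t) < 0 ∧ form t (vec s) < 0) ∨ (form s (vec t) = 0 ∧ form t (vec s) = 0))
    (separating : ∀ v, (∀ s, form s v = 0) → v = 0)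
    (exists_neg : ∃ y ≠ 0, ∀ s, form s y < 0) : MirrorPolytope n S where
  form := form
  vec := vec
  form_vec := form_vec
  properlyConvex := isProperlyConvex_iInter_halfSphere separating
  interior_nonempty :=
    let ⟨_, hy0, hy⟩ := exists_neg
    interior_iInter_halfSphere_nonempty hy0 hy
  minimal s h := by
    have hvec : vec s ≠ 0 := fun h0 => by simpa [h0] using form_vec s
    have hmem : toSphere ⟨vec s, hvec⟩ ∈ halfSphere (form s) :=
      h (mem_iInter₂.2 fun t ht => (toSphere_mem_halfSphere _ _).2
        ((neg_or_zero t s ht).elim (fun h => h.1.le) fun h => h.1.le))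
    rw [toSphere_mem_halfSphere, form_vec] at hmem
    linarith
  neg_or_zero := neg_or_zero

variable (P : MirrorPolytope n S)

/-- The labels of the facets through a given point. -/
def act (x : ProjSphere n) : Set S := {s | x ∈ sphereImage {v | P.form s v = 0}}

variable {P}

theorem toSphere_mem_carrier {v : {v : Vec n // v ≠ 0}} :
    toSphere v ∈ P.carrier ↔ v.1 ∈ polyhedron P.form 0 :=
  toSphere_mem_iInter_halfSphere

variable (P)

theorem act_toSphere (v : {v : Vec n // v ≠ 0}) :
    P.act (toSphere v) = activeSet P.form 0 v.1 :=
  ext fun _ => toSphere_mem_kerImage _ v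

theorem act_image_carrier :
    P.act '' P.carrier = activeSet P.form 0 '' (polyhedron P.form 0 \ {0}) := by
  ext J
  constructor
  · rintro ⟨x, hx, rfl⟩
    obtain ⟨v, rfl⟩ := toSphere_surjective x
    exact ⟨v.1, ⟨toSphere_mem_carrier.1 hx, v.2⟩, (P.act_toSphere v).symm⟩
  · rintro ⟨v, ⟨hv, hv0⟩, rfl⟩
    exact ⟨toSphere ⟨v, hv0⟩, toSphere_mem_carrier.2 hv, P.act_toSphere ⟨v, hv0⟩⟩

theorem eq_zero_of_activeSet_eq_univ {v : Vec n} (h : activeSet P.form 0 v = univ) : v = 0 := by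
  have hform : ∀ s, P.form s v = 0 := fun s => h.ge (mem_univ s)
  by_contra hv
  refine P.properlyConvex.2 (toSphere ⟨v, hv⟩)
    (subset_closure (toSphere_mem_carrier.2 fun s => (hform s).le)) (subset_closure ?_)
  rw [neg_toSphere]
  exact toSphere_mem_carrier.2 fun s => by simp [hform s]

theorem isFace_setOf_subset_act (J : Set S) :
    IsFace P.carrier {x ∈ P.carrier | J ⊆ P.act x} := by
  have := Fintype.ofFinite S
  classical
  refine ⟨∑ s ∈ J.toFinset, P.form s, fun x hx => ?_, ext fun x => and_congr_right fun hx => ?_⟩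
  all_goals
    obtain ⟨v, rfl⟩ := toSphere_surjective x
    rw [toSphere_mem_carrier] at hx
  · rw [toSphere_mem_halfSphere, LinearMap.sum_apply]
    exact Finset.sum_nonpos fun s _ => hx s
  · rw [toSphere_mem_kerImage, LinearMap.sum_apply, act_toSphere]
    simpa using (sum_eq_sum_iff_subset_activeSet (J := J.toFinset) hx).symm

theorem isFace_iff (F : Set (ProjSphere n)) :
    IsFace P.carrier F ↔ IsActiveFace P.carrier P.act F := by
  constructor
  · rintro ⟨φ, hφ, rfl⟩
    have hnonpos : ∀ v ∈ polyhedron P.form 0, φ v ≤ 0 := fun v hv => by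
      rcases eq_or_ne v 0 with rfl | hv0
      · simp
      · exact (toSphere_mem_halfSphere φ ⟨v, hv0⟩).1 (hφ (toSphere_mem_carrier.2 hv))
    have hzero : ∃ v ∈ polyhedron P.form 0, φ v = 0 :=
      ⟨0, mem_polyhedron_zero.2 fun s => (map_zero (P.form s)).le, map_zero φ⟩
    obtain ⟨w, hw, -, hiff⟩ := exists_eq_iff_activeSet_subset hnonpos hzero
    have hface : ∀ v : {v : Vec n // v ≠ 0}, toSphere v ∈ P.carrier →
        (toSphere v ∈ sphereImage {v | φ v = 0} ↔
          activeSet P.form 0 w ⊆ P.act (toSphere v)) := fun v hv => by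
      rw [toSphere_mem_kerImage, act_toSphere, hiff _ (toSphere_mem_carrier.1 hv)]
    rcases eq_or_ne w 0 with rfl | hw0
    · left
      refine eq_empty_of_forall_notMem ?_
      rintro x ⟨hx, hφx⟩
      obtain ⟨v, rfl⟩ := toSphere_surjective x
      rw [hface v hx, activeSet_zero_zero, act_toSphere, univ_subset_iff] at hφx
      exact v.2 (P.eq_zero_of_activeSet_eq_univ hφx)
    · refine Or.inr ⟨toSphere ⟨w, hw0⟩, toSphere_mem_carrier.2 hw,
        ext fun x => and_congr_right fun hx => ?_⟩
      obtain ⟨v, rfl⟩ := toSphere_surjective x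
      rw [hface v hx, P.act_toSphere ⟨w, hw0⟩]
  · rintro (rfl | ⟨x₀, -, rfl⟩)
    · convert P.isFace_setOf_subset_act univ
      refine (eq_empty_of_forall_notMem ?_).symm
      rintro x ⟨_, hx⟩
      obtain ⟨v, rfl⟩ := toSphere_surjective x
      rw [act_toSphere, univ_subset_iff] at hx
      exact v.2 (P.eq_zero_of_activeSet_eq_univ hx)
    · exact P.isFace_setOf_subset_act _

theorem span_coneOver_setOf_subset_act {y : Vec n} (hy0 : y ≠ 0) (hy : y ∈ polyhedron P.form 0) :
    Submodule.span ℝ (coneOver {x ∈ P.carrier | activeSet P.form 0 y ⊆ P.act x}) =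
      ⨅ s ∈ activeSet P.form 0 y, LinearMap.ker (P.form s) := by
  have hmem : ∀ v : Vec n, v ≠ 0 → v ∈ polyhedron P.form 0 →
      activeSet P.form 0 y ⊆ activeSet P.form 0 v →
      v ∈ Submodule.span ℝ (coneOver {x ∈ P.carrier | activeSet P.form 0 y ⊆ P.act x}) := by
    intro v hv0 hv hsub
    rw [← P.act_toSphere ⟨v, hv0⟩] at hsub
    exact Submodule.subset_span (mem_coneOver.2 ⟨hv0, toSphere_mem_carrier.2 hv, hsub⟩)
  refine le_antisymm (Submodule.span_le.2 fun v hv => ?_) fun v hv => ?_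
  · obtain ⟨hv0, -, hsub⟩ := mem_coneOver.1 hv
    rw [act_toSphere] at hsub
    simpa using fun s hs => mem_activeSet_zero.1 (hsub hs)
  · have hker : ∀ s ∈ activeSet P.form 0 y, P.form s v = 0 := by simpa using hv
    obtain ⟨ε, hε, hyv⟩ := exists_pos_add_smul_mem_polyhedron hy fun s hs => (hker s hs).le
    have hyv' : y + ε • v ∈
        Submodule.span ℝ (coneOver {x ∈ P.carrier | activeSet P.form 0 y ⊆ P.act x}) := by
      by_cases h0 : y + ε • v = 0
      · exact h0 ▸ Submodule.zero_mem _
      · refine hmem _ h0 hyv fun s hs => ?_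
        rw [mem_activeSet_zero, map_add, map_smul, hker s hs, mem_activeSet_zero.1 hs]
        simp
    rw [show v = ε⁻¹ • ((y + ε • v) - y) by simp [smul_smul, hε.ne']]
    exact Submodule.smul_mem _ _ (Submodule.sub_mem _ hyv' (hmem y hy0 hy Subset.rfl))

end MirrorPolytope

theorem exists_apply_eq_and_apply_eq {K V : Type*} [Field K] [NeZero (2 : K)] [AddCommGroup V]
    [Module K V] {φ ψ : Module.Dual K V} {b c : V} (hb : φ b = 2) (hc : ψ c = 2)
    (hd : φ c * ψ b ≠ 4) (p q : K) : ∃ v, φ v = p ∧ ψ v = q := by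
  have hd' : 4 - φ c * ψ b ≠ 0 := sub_ne_zero.2 hd.symm
  refine ⟨((2 * p - φ c * q) / (4 - φ c * ψ b)) • b +
    ((2 * q - ψ b * p) / (4 - φ c * ψ b)) • c, ?_, ?_⟩
  all_goals
    simp only [map_add, map_smul, smul_eq_mul, hb, hc]
    field_simp
    ring

theorem MirrorPolytope.isRidge_facet_inter {n : ℕ} {S : Type} [Finite S] (P : MirrorPolytope n S)
    {s t : S} {y : Vec n} (hy0 : y ≠ 0) (hy : y ∈ polyhedron P.form 0)
    (hact : activeSet P.form 0 y = {s, t}) (hd : P.form s (P.vec t) * P.form t (P.vec s) ≠ 4) :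
    IsRidge P.carrier (P.facet s ∩ P.facet t) := by
  have hface : P.facet s ∩ P.facet t = {x ∈ P.carrier | activeSet P.form 0 y ⊆ P.act x} := by
    simp only [hact, insert_subset_iff, singleton_subset_iff]
    exact (inter_inter_distrib_left P.carrier _ _).symm
  have hsurj : Function.Surjective ((P.form s).prod (P.form t)) := fun ⟨p, q⟩ =>
    (exists_apply_eq_and_apply_eq (P.form_vec s) (P.form_vec t) hd p q).imp fun _ h =>
      Prod.ext h.1 h.2
  rw [hface]
  refine ⟨P.isFace_setOf_subset_act _, ?_⟩
  rw [P.span_coneOver_setOf_subset_act hy0 hy, hact, iInf_pair, ← LinearMap.ker_prod]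
  have hrank := ((P.form s).prod (P.form t)).finrank_range_add_finrank_ker
  rw [LinearMap.range_eq_top.2 hsurj, finrank_top, Module.finrank_prod, Module.finrank_self,
    Module.finrank_fin_fun] at hrank
  omega

/-! ### Products of two reflections -/

section ProjRotation

variable {n : ℕ}

theorem isProjRotation_of_semiconj {g : Vec n →ₗ[ℝ] Vec n} {θ : ℝ} (hθ : 0 < θ)
    (hθ' : θ < 2 * π) (hdet : LinearMap.det g = 1) {L : Vec n →ₗ[ℝ] Fin 2 → ℝ}
    (hL : Function.Surjective L) (hker : ∀ v, L v = 0 → g v = v)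
    (hg : ∀ v, L (g v) = !![cos θ, -sin θ; sin θ, cos θ].mulVec (L v)) : IsProjRotation g θ := by
  let e := L.quotKerEquivOfSurjective hL
  refine ⟨hθ, hθ', hdet, LinearMap.ker L, fun v hv => ?_, hker, Module.Basis.ofEquivFun e, ?_⟩
  · rw [Submodule.mem_comap, LinearMap.mem_ker, hg, LinearMap.mem_ker.1 hv, Matrix.mulVec_zero]
  ext i j
  obtain ⟨v, hv⟩ := Submodule.Quotient.mk_surjective _ (Module.Basis.ofEquivFun e j)
  have hLv : L v = Pi.single j 1 := by
    rw [show L v = e (Submodule.Quotient.mk v) from rfl, hv, Module.Basis.coe_ofEquivFun,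
      LinearEquiv.apply_symm_apply]
  rw [LinearMap.toMatrix_apply, ← hv]
  change L (g v) i = _
  rw [hg, hLv, Matrix.mulVec_single_one, Matrix.col_apply]

variable {φ ψ : Module.Dual ℝ (Vec n)} {b c : Vec n}

theorem det_reflection (hb : φ b = 2) :
    LinearMap.det (Module.reflection hb : Vec n →ₗ[ℝ] Vec n) = -1 := by
  have htransvection :
      (Module.reflection hb : Vec n →ₗ[ℝ] Vec n) = LinearMap.transvection φ (-b) :=
    LinearMap.ext fun v => by
      rw [LinearMap.transvection.apply, smul_neg, ← sub_eq_add_neg]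
      exact Module.reflection_apply v hb
  rw [htransvection, LinearMap.transvection.det, map_neg, hb]
  norm_num

theorem exists_mul_eq_neg_sin_two_mul {p q θ : ℝ} (h0 : p = 0 ↔ q = 0)
    (h : p * q = 4 * cos θ ^ 2) (hsin : sin θ ≠ 0) :
    ∃ k : ℝ, k ≠ 0 ∧ k * q = -sin (2 * θ) ∧ -sin (2 * θ) * k = p * (1 - p * q / 4) := by
  by_cases hq : q = 0
  · have hcos : cos θ = 0 := by simpa [hq] using h.symm
    exact ⟨1, one_ne_zero, by simp [hq, sin_two_mul, hcos], by simp [h0.2 hq, sin_two_mul, hcos]⟩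
  · have hcos : cos θ ≠ 0 := fun hcos => hq (by simpa [hcos, h0] using h)
    refine ⟨-sin (2 * θ) / q, by simp [sin_two_mul, hsin, hcos, hq], div_mul_cancel₀ _ hq, ?_⟩
    have hsq : sin (2 * θ) ^ 2 = p * q * (1 - p * q / 4) := by
      rw [h, sin_two_mul, mul_pow, mul_pow, sin_sq]
      ring
    rw [← mul_div_assoc, neg_mul_neg, ← sq, hsq]
    field_simp

theorem reflection_reflection_apply (hb : φ b = 2) (hc : ψ c = 2) (v : Vec n) :
    Module.reflection hb (Module.reflection hc v) = v - ψ v • c - (φ v - ψ v * φ c) • b := by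
  simp [Module.reflection_apply]

/-- The map `(φ, ψ)` conjugates the product of the two reflections to a matrix with trace
`2 cos 2θ` and determinant `1`. Shearing makes its diagonal entries equal, and rescaling the second
coordinate by `k` turns it into a rotation matrix. -/
theorem isProjRotation_reflection_comp (hb : φ b = 2) (hc : ψ c = 2) (h0 : φ c = 0 ↔ ψ b = 0)
    {θ : ℝ} (hθ : 0 < θ) (hθ' : θ < π) (h : φ c * ψ b = 4 * cos θ ^ 2) :
    IsProjRotation ((Module.reflection hb : Vec n →ₗ[ℝ] Vec n) ∘ₗ
      (Module.reflection hc : Vec n →ₗ[ℝ] Vec n)) (2 * θ) := by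
  have hsin : 0 < sin θ := sin_pos_of_pos_of_lt_pi hθ hθ'
  obtain ⟨k, hk0, hkq, hkp⟩ := exists_mul_eq_neg_sin_two_mul h0 h hsin.ne'
  have hcos : cos (2 * θ) = φ c * ψ b / 2 - 1 := by rw [cos_two_mul, h]; ring
  let L : Vec n →ₗ[ℝ] Fin 2 → ℝ := LinearMap.pi ![φ - (φ c / 2) • ψ, k • ψ]
  have hL : ∀ v, L v = ![φ v - φ c / 2 * ψ v, k * ψ v] := fun v => by
    ext i
    fin_cases i <;> simp [L]
  refine isProjRotation_of_semiconj (L := L) (by linarith) (by linarith) ?_ (fun x => ?_)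
    (fun v hv => ?_) fun v => ?_
  · rw [LinearMap.det_comp, det_reflection, det_reflection]
    norm_num
  · have hd : φ c * ψ b ≠ 4 := by rw [h, cos_sq']; nlinarith
    obtain ⟨v, hφv, hψv⟩ :=
      exists_apply_eq_and_apply_eq hb hc hd (x 0 + φ c / 2 * (x 1 / k)) (x 1 / k)
    refine ⟨v, ?_⟩
    rw [hL, hφv, hψv, add_sub_cancel_right, mul_div_cancel₀ _ hk0]
    exact FinVec.etaExpand_eq x
  · rw [hL] at hv
    have hψv : ψ v = 0 := by simpa [hk0] using congrFun hv 1
    have hφv : φ v = 0 := by simpa [hψv] using congrFun hv 0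
    simp [reflection_reflection_apply, hψv, hφv]
  · simp only [LinearMap.comp_apply, LinearEquiv.coe_coe, hL,
      reflection_reflection_apply, map_sub, map_smul, smul_eq_mul, hb, hc, hcos]
    rw [Matrix.cons_mulVec, Matrix.cons_mulVec, Matrix.empty_mulVec, Matrix.vec2_dotProduct',
      Matrix.vec2_dotProduct', Matrix.vecCons_inj, Matrix.vecCons_inj]
    refine ⟨?_, ?_, rfl⟩
    · linear_combination (-ψ v) * hkp
    · linear_combination (-φ v + φ c / 2 * ψ v) * hkq

end ProjRotation

/-! ### Cones cut out of an orthant by a matrix -/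

/-- A matrix with diagonal entries `2` and negative off-diagonal entries whose principal minors of
order two are nonnegative and whose principal minors of order three are negative. These conditions
determine the combinatorics of the cone `{x ≥ 0, M x ≤ 0}`. -/
structure IsTripleNegative {ι : Type*} (M : Matrix ι ι ℝ) : Prop where
  diag : ∀ i, M i i = 2
  neg : ∀ i j, i ≠ j → M i j < 0
  mul_le : ∀ i j, i ≠ j → M i j * M j i ≤ 4
  minor_neg : ∀ i j k, i ≠ j → i ≠ k → j ≠ k →
    8 - 2 * (M i j * M j i + M j k * M k j + M i k * M k i) +
      M i j * M j k * M k i + M i k * M k j * M j i < 0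

/-- The forms defining the cone `{x ≥ 0, M x ≤ 0}`, labelled like the facets of a bitruncated
simplex: `Sum.inl i` stands for the truncating half-space `(M x)_i ≤ 0`, and `Sum.inr i` for the
half-space `x_i ≥ 0`. -/
def cutForm {ι : Type*} [Fintype ι] (M : Matrix ι ι ℝ) : ι ⊕ ι → Module.Dual ℝ (ι → ℝ) :=
  Sum.elim (fun i => (1 / 2 : ℝ) • (LinearMap.proj i ∘ₗ M.mulVecLin)) (fun i => -LinearMap.proj i)

section Cut

variable {ι : Type*} {M : Matrix ι ι ℝ}

section Forms

variable [Fintype ι] {y : ι → ℝ} {i : ι}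

@[simp] theorem cutForm_inl : cutForm M (Sum.inl i) y = 1 / 2 * M.mulVec y i := by
  simp [cutForm]

@[simp] theorem cutForm_inr : cutForm M (Sum.inr i) y = -y i := by
  simp [cutForm]

theorem mem_polyhedron_cutForm :
    y ∈ polyhedron (cutForm M) 0 ↔ (∀ i, M.mulVec y i ≤ 0) ∧ ∀ i, 0 ≤ y i := by
  simp only [mem_polyhedron_zero, Sum.forall, cutForm_inl, cutForm_inr, neg_nonpos]
  exact and_congr_left fun _ => forall_congr' fun _ => by constructor <;> intro h <;> linarith

theorem inl_mem_activeSet_cutForm :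
    Sum.inl i ∈ activeSet (cutForm M) 0 y ↔ M.mulVec y i = 0 := by
  simp [mem_activeSet_zero]

theorem inr_mem_activeSet_cutForm : Sum.inr i ∈ activeSet (cutForm M) 0 y ↔ y i = 0 := by
  simp [mem_activeSet_zero]

theorem sum_pos_of_mem_polyhedron_cutForm (hy0 : y ≠ 0) (hy : y ∈ polyhedron (cutForm M) 0) :
    0 < ∑ i, y i :=
  Fintype.sum_pos (lt_of_le_of_ne (fun i => (mem_polyhedron_cutForm.1 hy).2 i) hy0.symm)

end Forms

theorem IsTripleNegative.transpose (hM : IsTripleNegative M) : IsTripleNegative M.transpose where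
  diag := hM.diag
  neg i j h := hM.neg j i h.symm
  mul_le i j h := hM.mul_le j i h.symm
  minor_neg i j k hij hik hjk := by
    have hminor := hM.minor_neg i j k hij hik hjk
    simp only [Matrix.transpose_apply]
    linarith

theorem IsTripleNegative.mulVec_neg_of_apply_eq_zero [Fintype ι] (hM : IsTripleNegative M)
    {y : ι → ℝ} (hy : ∀ i, 0 ≤ y i) (hy0 : y ≠ 0) {i : ι} (hi : y i = 0) :
    M.mulVec y i < 0 := by
  obtain ⟨l, hl⟩ := Function.ne_iff.1 hy0
  have hil : i ≠ l := fun h => hl (h ▸ hi)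
  refine Finset.sum_neg' (fun j _ => ?_)
    ⟨l, Finset.mem_univ l, mul_neg_of_neg_of_pos (hM.neg i l hil) ((hy l).lt_of_ne' hl)⟩
  rcases eq_or_ne i j with rfl | hij
  · rw [hi, mul_zero]
  · exact mul_nonpos_of_nonpos_of_nonneg (hM.neg i j hij).le (hy j)

section CutVertex

variable [DecidableEq ι] {i j k l : ι}

/-- A vector supported on `{i, j, k}` with `(M x)_i = (M x)_j = 0`, spanning an extremal ray of
the cone `{x ≥ 0, M x ≤ 0}`. -/
def cutVertex (M : Matrix ι ι ℝ) (i j k : ι) : ι → ℝ :=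
  Pi.single i (M i j * M j k - 2 * M i k) + Pi.single j (M j i * M i k - 2 * M j k) +
    Pi.single k (4 - M i j * M j i)

theorem mulVec_cutVertex [Fintype ι] (i j k l : ι) :
    M.mulVec (cutVertex M i j k) l = M l i * (M i j * M j k - 2 * M i k) +
      M l j * (M j i * M i k - 2 * M j k) + M l k * (4 - M i j * M j i) := by
  simp [cutVertex, Matrix.mulVec_add, Matrix.mulVec_single]

theorem cutVertex_apply_of_ne (hli : l ≠ i) (hlj : l ≠ j) (hlk : l ≠ k) :
    cutVertex M i j k l = 0 := by
  simp [cutVertex, hli, hlj, hlk]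

theorem cutVertex_apply_right (hik : i ≠ k) (hjk : j ≠ k) :
    cutVertex M i j k k = 4 - M i j * M j i := by
  simp [cutVertex, hik.symm, hjk.symm]

namespace IsTripleNegative

theorem cutVertex_apply_left_pos (hM : IsTripleNegative M) (hij : i ≠ j) (hik : i ≠ k)
    (hjk : j ≠ k) : 0 < cutVertex M i j k i := by
  have hmul := mul_pos_of_neg_of_neg (hM.neg i j hij) (hM.neg j k hjk)
  have happly : cutVertex M i j k i = M i j * M j k - 2 * M i k := by simp [cutVertex, hij, hik]
  linarith [hM.neg i k hik]

theorem cutVertex_apply_mid_pos (hM : IsTripleNegative M) (hij : i ≠ j) (hik : i ≠ k)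
    (hjk : j ≠ k) : 0 < cutVertex M i j k j := by
  have hmul := mul_pos_of_neg_of_neg (hM.neg j i hij.symm) (hM.neg i k hik)
  have happly : cutVertex M i j k j = M j i * M i k - 2 * M j k := by
    simp [cutVertex, hij.symm, hjk]
  linarith [hM.neg j k hjk]

theorem cutVertex_nonneg (hM : IsTripleNegative M) (hij : i ≠ j) (hik : i ≠ k) (hjk : j ≠ k)
    (l : ι) : 0 ≤ cutVertex M i j k l := by
  rcases eq_or_ne l i with rfl | hli
  · exact (hM.cutVertex_apply_left_pos hij hik hjk).le
  rcases eq_or_ne l j with rfl | hlj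
  · exact (hM.cutVertex_apply_mid_pos hij hik hjk).le
  rcases eq_or_ne l k with rfl | hlk
  · rw [cutVertex_apply_right hik hjk]
    linarith [hM.mul_le i j hij]
  · exact (cutVertex_apply_of_ne hli hlj hlk).ge

variable [Fintype ι]

theorem mulVec_cutVertex_left (hM : IsTripleNegative M) :
    M.mulVec (cutVertex M i j k) i = 0 := by
  rw [mulVec_cutVertex, hM.diag]
  ring

theorem mulVec_cutVertex_mid (hM : IsTripleNegative M) :
    M.mulVec (cutVertex M i j k) j = 0 := by
  rw [mulVec_cutVertex, hM.diag]
  ring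

theorem mulVec_cutVertex_neg (hM : IsTripleNegative M) (hij : i ≠ j) (hik : i ≠ k) (hjk : j ≠ k)
    (hli : l ≠ i) (hlj : l ≠ j) : M.mulVec (cutVertex M i j k) l < 0 := by
  rcases eq_or_ne l k with rfl | hlk
  · rw [mulVec_cutVertex, hM.diag]
    linarith [hM.minor_neg i j l hij hik hjk]
  · exact hM.mulVec_neg_of_apply_eq_zero (hM.cutVertex_nonneg hij hik hjk)
      (Function.ne_iff.2 ⟨i, (hM.cutVertex_apply_left_pos hij hik hjk).ne'⟩)
      (cutVertex_apply_of_ne hli hlj hlk)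

theorem mulVec_cutVertex_nonpos (hM : IsTripleNegative M) (hij : i ≠ j) (hik : i ≠ k)
    (hjk : j ≠ k) (l : ι) : M.mulVec (cutVertex M i j k) l ≤ 0 := by
  rcases eq_or_ne l i with rfl | hli
  · exact hM.mulVec_cutVertex_left.le
  rcases eq_or_ne l j with rfl | hlj
  · exact hM.mulVec_cutVertex_mid.le
  · exact (hM.mulVec_cutVertex_neg hij hik hjk hli hlj).le

theorem cutVertex_mem_polyhedron (hM : IsTripleNegative M) (hij : i ≠ j) (hik : i ≠ k)
    (hjk : j ≠ k) : cutVertex M i j k ∈ polyhedron (cutForm M) 0 :=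
  mem_polyhedron_cutForm.2
    ⟨hM.mulVec_cutVertex_nonpos hij hik hjk, hM.cutVertex_nonneg hij hik hjk⟩

theorem subset_activeSet_cutVertex (hM : IsTripleNegative M) {J : Set (ι ⊕ ι)}
    (hT : Sum.inl ⁻¹' J ⊆ {i, j}) (hi : Sum.inr i ∉ J) (hj : Sum.inr j ∉ J) (hk : Sum.inr k ∉ J) :
    J ⊆ activeSet (cutForm M) 0 (cutVertex M i j k) := by
  rintro (l | l) hl
  · rw [inl_mem_activeSet_cutForm]
    rcases hT hl with rfl | rfl
    exacts [hM.mulVec_cutVertex_left, hM.mulVec_cutVertex_mid]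
  · exact inr_mem_activeSet_cutForm.2 (cutVertex_apply_of_ne (ne_of_mem_of_not_mem hl hi <| · ▸ rfl)
      (ne_of_mem_of_not_mem hl hj <| · ▸ rfl) (ne_of_mem_of_not_mem hl hk <| · ▸ rfl))

end IsTripleNegative

end CutVertex

end Cut

section ActiveSets

variable {ι : Type*} {M : Matrix ι ι ℝ}

/-- The index sets `{F'_i | i ∈ T} ∪ {F_i | i ∈ Z}` of the families of facets of a bitruncated
simplex with a common point: `T ∩ Z = ∅`, `T` has at most two elements, and the complement of `Z`
has at least three. -/
def IsBitruncatedActive (J : Set (ι ⊕ ι)) : Prop :=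
  Disjoint (Sum.inl ⁻¹' J) (Sum.inr ⁻¹' J) ∧ (Sum.inl ⁻¹' J).ncard ≤ 2 ∧
    2 < (Sum.inr ⁻¹' J)ᶜ.ncard

theorem exists_pair_between [Finite ι] {T U : Set ι} (hTU : T ⊆ U) (hT : T.ncard ≤ 2)
    (hU : 2 ≤ U.ncard) : ∃ i j, i ≠ j ∧ T ⊆ {i, j} ∧ {i, j} ⊆ U := by
  obtain ⟨A, hTA, hAU, hA⟩ := exists_subsuperset_card_eq hTU hT hU
  obtain ⟨i, j, hij, rfl⟩ := ncard_eq_two.1 hA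
  exact ⟨i, j, hij, hTA, hAU⟩

namespace IsTripleNegative

variable [Fintype ι] {y : ι → ℝ}

theorem exists_cutForm_neg (hM : IsTripleNegative M) (hι : 3 ≤ Nat.card ι) :
    ∃ y, ∀ q, cutForm M q y < 0 := by
  classical
  have hother : ∀ i : ι, ∃ j k, j ≠ k ∧ i ≠ j ∧ i ≠ k := fun i => by
    have hcard : ({i}ᶜ : Set ι).ncard = Nat.card ι - 1 := by rw [ncard_compl, ncard_singleton]
    obtain ⟨j, k, hjk, -, hsub⟩ := exists_pair_between (empty_subset ({i}ᶜ : Set ι)) (by simp)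
      (by omega)
    exact ⟨j, k, hjk, Ne.symm (hsub (mem_insert j _)), Ne.symm (hsub (mem_insert_of_mem j rfl))⟩
  obtain ⟨y, hmem, hact⟩ := exists_activeSet_eq (ℓ := cutForm M) (J := ∅) <| by
    rintro (i | i) -
    all_goals obtain ⟨j, k, hjk, hij, hik⟩ := hother i
    · refine ⟨cutVertex M j k i, hM.cutVertex_mem_polyhedron hjk hij.symm hik.symm,
        empty_subset _, ?_⟩
      rw [inl_mem_activeSet_cutForm]
      exact (hM.mulVec_cutVertex_neg hjk hij.symm hik.symm hij hik).ne
    · refine ⟨cutVertex M i j k, hM.cutVertex_mem_polyhedron hij hik hjk, empty_subset _, ?_⟩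
      rw [inr_mem_activeSet_cutForm]
      exact (hM.cutVertex_apply_left_pos hij hik hjk).ne'
  exact ⟨y, fun q => lt_of_notMem_activeSet hmem (hact ▸ notMem_empty q)⟩

theorem exists_pos_mulVec_neg (hM : IsTripleNegative M) (hι : 3 ≤ Nat.card ι) :
    ∃ y : ι → ℝ, (∀ i, 0 < y i) ∧ ∀ i, M.mulVec y i < 0 := by
  obtain ⟨y, hy⟩ := hM.exists_cutForm_neg hι
  refine ⟨y, fun i => ?_, fun i => ?_⟩
  · simpa using hy (Sum.inr i)
  · have hneg := hy (Sum.inl i)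
    rw [cutForm_inl] at hneg
    linarith

/-- If `(M y)_i = (M y)_j = (M y)_k = 0`, pair `M y` with the vertex of the transposed matrix
supported on `{i, j, k}`. -/
theorem ncard_preimage_inl_activeSet_le (hM : IsTripleNegative M) (hy0 : y ≠ 0)
    (hy : y ∈ polyhedron (cutForm M) 0) :
    (Sum.inl ⁻¹' activeSet (cutForm M) 0 y).ncard ≤ 2 := by
  classical
  by_contra! hcard
  obtain ⟨i, hi, j, hj, k, hk, hij, hik, hjk⟩ := (two_lt_ncard (toFinite _)).1 hcard
  simp only [mem_preimage, inl_mem_activeSet_cutForm] at hi hj hk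
  have hnonneg := (mem_polyhedron_cutForm.1 hy).2
  have hyk : 0 < y k := (hnonneg k).lt_of_ne' fun h =>
    (hM.mulVec_neg_of_apply_eq_zero hnonneg hy0 h).ne hk
  set u := cutVertex M.transpose i j k with hu
  have hzero : u ⬝ᵥ M.mulVec y = 0 := Finset.sum_eq_zero fun l _ => by
    by_cases hl : l = i ∨ l = j ∨ l = k
    · rcases hl with rfl | rfl | rfl <;> simp [*]
    · push Not at hl
      rw [hu, cutVertex_apply_of_ne hl.1 hl.2.1 hl.2.2, zero_mul]
  have hneg : M.transpose.mulVec u ⬝ᵥ y < 0 :=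
    Finset.sum_neg' (fun l _ => mul_nonpos_of_nonpos_of_nonneg
      (hM.transpose.mulVec_cutVertex_nonpos hij hik hjk l) (hnonneg l)) ⟨k, Finset.mem_univ k,
        mul_neg_of_neg_of_pos (hM.transpose.mulVec_cutVertex_neg hij hik hjk hik.symm hjk.symm) hyk⟩
  rw [Matrix.mulVec_transpose, ← Matrix.dotProduct_mulVec, hzero] at hneg
  exact lt_irrefl 0 hneg

/-- Here the `2 × 2` minors enter: `M y ≤ 0` has no nonzero solution `y ≥ 0` supported on two
indices. -/
theorem two_lt_ncard_compl_preimage_inr_activeSet (hM : IsTripleNegative M)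
    (hlt : ∀ i j, i ≠ j → M i j * M j i < 4) (hy0 : y ≠ 0) (hy : y ∈ polyhedron (cutForm M) 0) :
    2 < (Sum.inr ⁻¹' activeSet (cutForm M) 0 y)ᶜ.ncard := by
  obtain ⟨hle, hnonneg⟩ := mem_polyhedron_cutForm.1 hy
  have hpos : ∀ {i}, y i ≠ 0 → 0 < y i := fun h => (hnonneg _).lt_of_ne' h
  obtain ⟨p, hp⟩ := Function.ne_iff.1 hy0
  obtain ⟨q, hqp, hq⟩ : ∃ q, q ≠ p ∧ y q ≠ 0 := by
    by_contra! hzero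
    have hsum : M.mulVec y p = M p p * y p :=
      Fintype.sum_eq_single p fun q hq => by rw [hzero q hq, mul_zero]
    rw [hM.diag] at hsum
    linarith [hle p, hpos hp]
  obtain ⟨r, hrp, hrq, hr⟩ : ∃ r, r ≠ p ∧ r ≠ q ∧ y r ≠ 0 := by
    by_contra! hzero
    have hsum : ∀ i, M.mulVec y i = M i p * y p + M i q * y q := fun i =>
      Fintype.sum_eq_add p q hqp.symm fun r hr => by rw [hzero r hr.1 hr.2, mul_zero]
    have hp_le : 2 * y p + M p q * y q ≤ 0 := by rw [← hM.diag p, ← hsum]; exact hle p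
    have hq_le : M q p * y p + 2 * y q ≤ 0 := by rw [← hM.diag q, ← hsum]; exact hle q
    have hminor := mul_pos (sub_pos.2 (hlt p q hqp.symm)) (hpos hp)
    have hmul := mul_le_mul_of_nonpos_left hq_le (hM.neg p q hqp.symm).le
    linarith
  refine (two_lt_ncard (toFinite _)).2
    ⟨p, ?_, q, ?_, r, ?_, hqp.symm, hrp.symm, hrq.symm⟩ <;>
    simpa [inr_mem_activeSet_cutForm]

theorem isBitruncatedActive_activeSet (hM : IsTripleNegative M)
    (hlt : ∀ i j, i ≠ j → M i j * M j i < 4) (hy0 : y ≠ 0) (hy : y ∈ polyhedron (cutForm M) 0) :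
    IsBitruncatedActive (activeSet (cutForm M) 0 y) := by
  refine ⟨disjoint_left.2 fun i hi hi' => ?_, hM.ncard_preimage_inl_activeSet_le hy0 hy,
    hM.two_lt_ncard_compl_preimage_inr_activeSet hlt hy0 hy⟩
  exact (hM.mulVec_neg_of_apply_eq_zero (mem_polyhedron_cutForm.1 hy).2 hy0
    (inr_mem_activeSet_cutForm.1 hi')).ne (inl_mem_activeSet_cutForm.1 hi)

theorem exists_activeSet_cutForm_eq (hM : IsTripleNegative M)
    (hlt : ∀ i j, i ≠ j → M i j * M j i < 4) {J : Set (ι ⊕ ι)} (hJ : IsBitruncatedActive J) :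
    ∃ y ∈ polyhedron (cutForm M) 0, activeSet (cutForm M) 0 y = J := by
  classical
  obtain ⟨hdisj, hT, hU⟩ := hJ
  have hTU : Sum.inl ⁻¹' J ⊆ (Sum.inr ⁻¹' J)ᶜ := disjoint_left.1 hdisj
  have hthird : ∀ i j : ι, ∃ k ∈ (Sum.inr ⁻¹' J)ᶜ, k ∉ ({i, j} : Set ι) := fun i j =>
    exists_mem_notMem_of_ncard_lt_ncard <| by
      have hpair := ncard_insert_le i {j}
      rw [ncard_singleton] at hpair
      omega
  refine exists_activeSet_eq ?_
  rintro (p | p) hp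
  · have hremove := pred_ncard_le_ncard_sdiff_singleton (Sum.inr ⁻¹' J)ᶜ p
    obtain ⟨i, j, hij, hTij, hsub⟩ := exists_pair_between
      (subset_sdiff_singleton hTU hp) hT (by omega)
    obtain ⟨⟨hi, hpi⟩, hj, hpj⟩ := pair_subset_iff.1 hsub
    obtain ⟨k, hk, hkij⟩ := hthird i j
    obtain ⟨hki, hkj⟩ := not_or.1 hkij
    refine ⟨cutVertex M i j k, hM.cutVertex_mem_polyhedron hij (Ne.symm hki) (Ne.symm hkj),
      hM.subset_activeSet_cutVertex hTij hi hj hk, ?_⟩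
    rw [inl_mem_activeSet_cutForm]
    exact (hM.mulVec_cutVertex_neg hij (Ne.symm hki) (Ne.symm hkj) (Ne.symm hpi)
      (Ne.symm hpj)).ne
  · obtain ⟨i, j, hij, hTij, hsub⟩ := exists_pair_between hTU hT hU.le
    obtain ⟨hi, hj⟩ := pair_subset_iff.1 hsub
    obtain ⟨k, hk, hkij, hpk⟩ : ∃ k ∈ (Sum.inr ⁻¹' J)ᶜ, k ∉ ({i, j} : Set ι) ∧
        (p = i ∨ p = j ∨ p = k) := by
      by_cases hpij : p ∈ ({i, j} : Set ι)
      · exact (hthird i j).imp fun k hk => ⟨hk.1, hk.2, hpij.imp_right Or.inl⟩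
      · exact ⟨p, hp, hpij, Or.inr (Or.inr rfl)⟩
    obtain ⟨hki, hkj⟩ := not_or.1 hkij
    refine ⟨cutVertex M i j k, hM.cutVertex_mem_polyhedron hij (Ne.symm hki) (Ne.symm hkj),
      hM.subset_activeSet_cutVertex hTij hi hj hk, ?_⟩
    rw [inr_mem_activeSet_cutForm]
    rcases hpk with rfl | rfl | rfl
    · exact (hM.cutVertex_apply_left_pos hij (Ne.symm hki) (Ne.symm hkj)).ne'
    · exact (hM.cutVertex_apply_mid_pos hij (Ne.symm hki) (Ne.symm hkj)).ne'
    · rw [cutVertex_apply_right (Ne.symm hki) (Ne.symm hkj)]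
      exact (sub_pos.2 (hlt i j hij)).ne'

theorem image_activeSet_cutForm (hM : IsTripleNegative M)
    (hlt : ∀ i j, i ≠ j → M i j * M j i < 4) :
    activeSet (cutForm M) 0 '' (polyhedron (cutForm M) 0 \ {0}) = {J | IsBitruncatedActive J} := by
  ext J
  constructor
  · rintro ⟨y, ⟨hy, hy0⟩, rfl⟩
    exact hM.isBitruncatedActive_activeSet hlt hy0 hy
  · intro hJ
    obtain ⟨y, hy, rfl⟩ := hM.exists_activeSet_cutForm_eq hlt hJ
    refine ⟨y, ⟨hy, ?_⟩, rfl⟩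
    rintro rfl
    simpa using hJ.2.2

end IsTripleNegative

end ActiveSets

section StepMatrix

variable {ι : Type*} [LinearOrder ι] {a b : ℝ} {i j k : ι}

/-- The matrix with diagonal entries `2`, entries `-a` above and `-b` below the diagonal. Up to
conjugation by a diagonal matrix, both diagonal blocks of `C_t` are of this form. -/
def stepMatrix (a b : ℝ) : Matrix ι ι ℝ :=
  Matrix.of fun i j => if i = j then 2 else -(if i < j then a else b)

theorem stepMatrix_self (a b : ℝ) (i : ι) : stepMatrix a b i i = 2 := by simp [stepMatrix]

theorem stepMatrix_of_ne (a b : ℝ) (hij : i ≠ j) :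
    stepMatrix a b i j = -(if i < j then a else b) := by
  simp [stepMatrix, hij]

theorem stepMatrix_mul_stepMatrix (hij : i ≠ j) :
    stepMatrix a b i j * stepMatrix a b j i = a * b := by
  rw [stepMatrix_of_ne a b hij, stepMatrix_of_ne a b hij.symm]
  rcases hij.lt_or_gt with h | h <;> simp only [h, h.not_gt, if_true, if_false] <;> ring

theorem stepMatrix_cycle_add_cycle (hij : i ≠ j) (hik : i ≠ k) (hjk : j ≠ k) :
    stepMatrix a b i j * stepMatrix a b j k * stepMatrix a b k i +
      stepMatrix a b i k * stepMatrix a b k j * stepMatrix a b j i = -(a * b * (a + b)) := by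
  simp only [stepMatrix_of_ne a b hij, stepMatrix_of_ne a b hik, stepMatrix_of_ne a b hjk,
    stepMatrix_of_ne a b hij.symm, stepMatrix_of_ne a b hik.symm, stepMatrix_of_ne a b hjk.symm]
  rcases hij.lt_or_gt with h | h <;> rcases hik.lt_or_gt with h' | h' <;>
    rcases hjk.lt_or_gt with h'' | h'' <;>
    simp only [h, h', h'', h.not_gt, h'.not_gt, h''.not_gt, if_true, if_false] <;>
    first
      | exact absurd (h.trans h'') h'.not_gt
      | exact absurd (h''.trans h) h'.not_gt
      | ring

theorem isTripleNegative_stepMatrix (ha : 0 < a) (hb : 0 < b) (hab : a * b ≤ 4)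
    (hdet : 8 - 6 * (a * b) - a * b * (a + b) < 0) :
    IsTripleNegative (stepMatrix a b : Matrix ι ι ℝ) where
  diag := stepMatrix_self a b
  neg i j hij := by
    rw [stepMatrix_of_ne a b hij]
    split_ifs <;> linarith
  mul_le i j hij := by rwa [stepMatrix_mul_stepMatrix hij]
  minor_neg i j k hij hik hjk := by
    rw [stepMatrix_mul_stepMatrix hij, stepMatrix_mul_stepMatrix hjk,
      stepMatrix_mul_stepMatrix hik, add_assoc, stepMatrix_cycle_add_cycle hij hik hjk]
    linarith

end StepMatrix

theorem IsTripleNegative.conj {ι : Type*} {M : Matrix ι ι ℝ} (hM : IsTripleNegative M)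
    {d : ι → ℝ} (hd : ∀ i, 0 < d i) :
    IsTripleNegative (Matrix.of fun i j => M i j * (d i / d j)) where
  diag i := by rw [Matrix.of_apply, hM.diag, div_self (hd i).ne', mul_one]
  neg i j hij := mul_neg_of_neg_of_pos (hM.neg i j hij) (div_pos (hd i) (hd j))
  mul_le i j hij := by
    have hi := (hd i).ne'
    have hj := (hd j).ne'
    calc M i j * (d i / d j) * (M j i * (d j / d i)) = M i j * M j i := by field_simp
      _ ≤ 4 := hM.mul_le i j hij
  minor_neg i j k hij hik hjk := by
    have hi := (hd i).ne'
    have hj := (hd j).ne'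
    have hk := (hd k).ne'
    calc _ = 8 - 2 * (M i j * M j i + M j k * M k j + M i k * M k i) +
          M i j * M j k * M k i + M i k * M k j * M j i := by
            simp only [Matrix.of_apply]
            field_simp
      _ < 0 := hM.minor_neg i j k hij hik hjk

/-! ### The regular simplex and its truncations -/

namespace IsRegularSimplex

variable {v : Fin 5 → E4}

theorem exists_five_mul_norm_sq_eq (hv : IsRegularSimplex v) :
    ∃ l : ℝ, 0 < l ∧ (∀ i j, i ≠ j → dist (v i) (v j) = l) ∧ ∀ i, 5 * ‖v i‖ ^ 2 = 2 * l ^ 2 := by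
  obtain ⟨hsum, l, hl, hdist⟩ := hv
  have hexpand : ∀ i, ∑ j, dist (v i) (v j) ^ 2 = 5 * ‖v i‖ ^ 2 + ∑ j, ‖v j‖ ^ 2 := fun i => by
    simp_rw [dist_eq_norm, norm_sub_sq_real, Finset.sum_add_distrib, Finset.sum_sub_distrib,
      ← Finset.mul_sum, ← inner_sum, hsum]
    simp
  have hcount : ∀ i, ∑ j, dist (v i) (v j) ^ 2 = 4 * l ^ 2 := fun i => by
    rw [← Finset.add_sum_erase _ _ (Finset.mem_univ i), dist_self,
      Finset.sum_congr rfl fun j hj => by rw [hdist i j (Finset.ne_of_mem_erase hj).symm]]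
    simp
  have htotal : ∑ j, ‖v j‖ ^ 2 = 5 * ‖v 0‖ ^ 2 := by
    rw [Finset.sum_congr rfl fun j _ => show ‖v j‖ ^ 2 = ‖v 0‖ ^ 2 by
      linarith [hexpand j, hcount j, hexpand 0, hcount 0]]
    simp
  exact ⟨l, hl, hdist, fun i => by linarith [hexpand i, hcount i, hexpand 0, hcount 0]⟩

theorem norm_pos (hv : IsRegularSimplex v) (i : Fin 5) : 0 < ‖v i‖ := by
  obtain ⟨l, hl, -, hnorm⟩ := hv.exists_five_mul_norm_sq_eq
  have hsq : 0 < ‖v i‖ ^ 2 := by linarith [hnorm i, pow_pos hl 2]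
  exact (norm_nonneg _).lt_of_ne' (sq_pos_iff.1 hsq)

theorem norm_eq (hv : IsRegularSimplex v) (i j : Fin 5) : ‖v i‖ = ‖v j‖ := by
  obtain ⟨l, -, -, hnorm⟩ := hv.exists_five_mul_norm_sq_eq
  exact (pow_left_inj₀ (norm_nonneg _) (norm_nonneg _) two_ne_zero).1
    (by linarith [hnorm i, hnorm j])

theorem inner_of_ne (hv : IsRegularSimplex v) {i j : Fin 5} (hij : i ≠ j) :
    inner ℝ (v i) (v j) = -(‖v i‖ ^ 2 / 4) := by
  obtain ⟨l, -, hdist, hnorm⟩ := hv.exists_five_mul_norm_sq_eq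
  have hsub := norm_sub_sq_real (v i) (v j)
  rw [← dist_eq_norm, hdist i j hij] at hsub
  linarith [hnorm i, hnorm j]

theorem inner_sum_smul (hv : IsRegularSimplex v) (i : Fin 5) (w : Fin 5 → ℝ) :
    inner ℝ (v i) (∑ j, w j • v j) = ‖v i‖ ^ 2 * (5 / 4 * w i - (∑ j, w j) / 4) := by
  have hterm : ∀ j, inner ℝ (v i) (w j • v j) =
      (if i = j then 5 / 4 * ‖v i‖ ^ 2 * w j else 0) - ‖v i‖ ^ 2 / 4 * w j := fun j => by
    rw [inner_smul_right]
    split_ifs with hij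
    · rw [← hij, real_inner_self_eq_norm_sq]
      ring
    · rw [hv.inner_of_ne hij]
      ring
  simp_rw [inner_sum, hterm, Finset.sum_sub_distrib, Finset.sum_ite_eq, ← Finset.mul_sum,
    Finset.mem_univ, if_true]
  ring

/-- The homogeneous barycentric coordinates `w` of the point `∑ w_i v_i` at height `∑ w_i`. -/
def coordEquiv (hv : IsRegularSimplex v) : Vec 4 ≃ₗ[ℝ] E4 × ℝ :=
  LinearMap.linearEquivOfInjective
    ((Fintype.linearCombination ℝ v).prod (Fintype.linearCombination ℝ fun _ => (1 : ℝ)))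
    (by
      refine (injective_iff_map_eq_zero _).2 fun w hw => funext fun i => ?_
      have hpoint : ∑ j, w j • v j = 0 := congrArg Prod.fst hw
      have hheight : ∑ j, w j = 0 := by
        simpa [Fintype.linearCombination_apply] using congrArg Prod.snd hw
      have hinner := hv.inner_sum_smul i w
      rw [hpoint, hheight, inner_zero_right] at hinner
      simpa [(hv.norm_pos i).ne'] using hinner.symm)
    (by simp)

theorem coordEquiv_apply (hv : IsRegularSimplex v) (w : Vec 4) :
    hv.coordEquiv w = (∑ j, w j • v j, ∑ j, w j) := by
  simp [coordEquiv, Fintype.linearCombination_apply]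

theorem sum_of_coordEquiv (hv : IsRegularSimplex v) {w : Vec 4} {p : E4 × ℝ}
    (hw : hv.coordEquiv w = p) : ∑ j, w j = p.2 := by
  rw [← hw, coordEquiv_apply]

theorem inner_of_coordEquiv (hv : IsRegularSimplex v) {w : Vec 4} {p : E4 × ℝ}
    (hw : hv.coordEquiv w = p) (i : Fin 5) :
    inner ℝ (v i) p.1 = ‖v i‖ ^ 2 * (5 / 4 * w i - p.2 / 4) := by
  rw [← hw, coordEquiv_apply, hv.inner_sum_smul]

theorem exists_pos_coordEquiv_smul_eq (hv : IsRegularSimplex v) {M : Matrix (Fin 5) (Fin 5) ℝ}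
    {y : Vec 4} (hy0 : y ≠ 0) (hy : y ∈ polyhedron (cutForm M) 0) :
    ∃ r : ℝ, 0 < r ∧ ∃ x, hv.coordEquiv (r • y) = (x, 1) := by
  have hpos := sum_pos_of_mem_polyhedron_cutForm hy0 hy
  refine ⟨(∑ i, y i)⁻¹, inv_pos.2 hpos, _, Prod.ext rfl ?_⟩
  rw [map_smul, coordEquiv_apply, Prod.smul_snd, smul_eq_mul, inv_mul_cancel₀ hpos.ne']

end IsRegularSimplex

section CutSimplex

variable {v : Fin 5 → E4} {s : ℝ}

/-- The outward normals of the half-spaces that cut out `Q_s`. -/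
def cutDual (v : Fin 5 → E4) : FacetIdx → StrongDual ℝ E4 :=
  Sum.elim (fun i => innerSL ℝ (v i)) (fun i => -innerSL ℝ (v i))

/-- The right-hand sides of the inequalities that cut out `Q_s`. -/
def cutBound (v : Fin 5 → E4) (s : ℝ) : FacetIdx → ℝ :=
  Sum.elim (fun i => ‖v i‖ * s) (fun i => ‖v i‖ ^ 2 / 4)

/-- The labels of the facets of `Q_s` through a given point. -/
def cutActiveSet (v : Fin 5 → E4) (s : ℝ) (x : E4) : Set FacetIdx := {k | x ∈ cutHyperplane v s k}

theorem cutSimplex_eq_polyhedron :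
    cutSimplex v s = polyhedron (fun k => (cutDual v k).toLinearMap) (cutBound v s) := by
  ext x
  simp only [cutSimplex, mem_iInter]
  refine forall_congr' ?_
  rintro (i | i)
  · rfl
  · exact show -(‖v i‖ ^ 2 / 4) ≤ inner ℝ (v i) x ↔ -inner ℝ (v i) x ≤ ‖v i‖ ^ 2 / 4 from neg_le

theorem cutActiveSet_eq_activeSet :
    cutActiveSet v s = activeSet (fun k => (cutDual v k).toLinearMap) (cutBound v s) := by
  ext x (i | i)
  exacts [Iff.rfl, neg_eq_iff_eq_neg.symm]

theorem isExposed_cutSimplex_iff (v : Fin 5 → E4) (s : ℝ) (B : Set E4) :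
    IsExposed ℝ (cutSimplex v s) B ↔ IsActiveFace (cutSimplex v s) (cutActiveSet v s) B := by
  rw [cutSimplex_eq_polyhedron, cutActiveSet_eq_activeSet]
  exact isExposed_polyhedron_iff _ _ B

end CutSimplex

/-- The matrix with diagonal entries `2` and off-diagonal entries `-m`. Its cones
`{x ≥ 0, M x ≤ 0}`, for `1 < m ≤ 2`, are the cones over the polytopes `Q_s`, with `m = 2` for the
rectified simplex. -/
def simplexMatrix (m : ℝ) : Matrix (Fin 5) (Fin 5) ℝ := stepMatrix m m

section SimplexMatrix

variable {m : ℝ}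

theorem simplexMatrix_self (m : ℝ) (i : Fin 5) : simplexMatrix m i i = 2 := stepMatrix_self m m i

theorem simplexMatrix_of_ne (m : ℝ) {i j : Fin 5} (h : i ≠ j) : simplexMatrix m i j = -m := by
  rw [simplexMatrix, stepMatrix_of_ne m m h, ite_self]

theorem simplexMatrix_mulVec (m : ℝ) (w : Fin 5 → ℝ) (i : Fin 5) :
    (simplexMatrix m).mulVec w i = (2 + m) * w i - m * ∑ j, w j := by
  have hterm : ∀ j, simplexMatrix m i j * w j =
      (if i = j then (2 + m) * w j else 0) - m * w j := fun j => by
    rcases eq_or_ne i j with rfl | hij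
    · rw [simplexMatrix_self, if_pos rfl]
      ring
    · rw [simplexMatrix_of_ne m hij, if_neg hij]
      ring
  simp_rw [Matrix.mulVec, dotProduct, hterm, Finset.sum_sub_distrib, Finset.sum_ite_eq,
    ← Finset.mul_sum, Finset.mem_univ, if_true]

theorem isTripleNegative_simplexMatrix (hm : 1 < m) (hm' : m ≤ 2) :
    IsTripleNegative (simplexMatrix m) := by
  refine isTripleNegative_stepMatrix (by linarith) (by linarith) (by nlinarith) ?_
  calc 8 - 6 * (m * m) - m * m * (m + m) = 2 * (2 + m) ^ 2 * (1 - m) := by ring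
    _ < 0 := mul_neg_of_pos_of_neg (by positivity) (by linarith)

end SimplexMatrix

namespace IsRegularSimplex

variable {v : Fin 5 → E4} {s m : ℝ} {w : Vec 4} {x : E4}

theorem exists_pos_cutDual_sub_cutBound_eq (hv : IsRegularSimplex v) (hm : 0 < m)
    (hs : 2 * s * (2 + m) = ‖v 0‖ * (2 * m - 1)) (hw : hv.coordEquiv w = (x, 1)) (k : FacetIdx) :
    ∃ K : ℝ, 0 < K ∧ cutDual v k x - cutBound v s k = K * cutForm (simplexMatrix m) k w := by
  have hnorm := hv.norm_pos 0
  rcases k with i | i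
  · refine ⟨5 * ‖v 0‖ ^ 2 / (2 * (2 + m)), by positivity, ?_⟩
    have hs' : s = ‖v 0‖ * (2 * m - 1) / (2 * (2 + m)) := by
      field_simp
      linarith
    change inner ℝ (v i) x - ‖v i‖ * s = _
    rw [hv.inner_of_coordEquiv hw i, cutForm_inl, simplexMatrix_mulVec, hv.sum_of_coordEquiv hw,
      hv.norm_eq i 0, hs']
    field_simp
    ring
  · refine ⟨5 / 4 * ‖v 0‖ ^ 2, by positivity, ?_⟩
    change -inner ℝ (v i) x - ‖v i‖ ^ 2 / 4 = _
    rw [hv.inner_of_coordEquiv hw i, cutForm_inr, hv.norm_eq i 0]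
    ring

theorem mem_cutSimplex_iff (hv : IsRegularSimplex v) (hm : 0 < m)
    (hs : 2 * s * (2 + m) = ‖v 0‖ * (2 * m - 1)) (hw : hv.coordEquiv w = (x, 1)) :
    x ∈ cutSimplex v s ↔ w ∈ polyhedron (cutForm (simplexMatrix m)) 0 := by
  rw [cutSimplex_eq_polyhedron]
  refine forall_congr' fun k => ?_
  obtain ⟨K, hK, heq⟩ := hv.exists_pos_cutDual_sub_cutBound_eq hm hs hw k
  exact sub_nonpos.symm.trans (heq ▸ smul_nonpos_iff_nonpos_of_pos_left hK)

theorem cutActiveSet_eq (hv : IsRegularSimplex v) (hm : 0 < m)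
    (hs : 2 * s * (2 + m) = ‖v 0‖ * (2 * m - 1)) (hw : hv.coordEquiv w = (x, 1)) :
    cutActiveSet v s x = activeSet (cutForm (simplexMatrix m)) 0 w := by
  rw [cutActiveSet_eq_activeSet]
  ext k
  obtain ⟨K, hK, heq⟩ := hv.exists_pos_cutDual_sub_cutBound_eq hm hs hw k
  exact sub_eq_zero.symm.trans (heq ▸ mul_eq_zero_iff_left hK.ne')

theorem image_cutActiveSet (hv : IsRegularSimplex v) (hm : 0 < m)
    (hs : 2 * s * (2 + m) = ‖v 0‖ * (2 * m - 1)) :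
    cutActiveSet v s '' cutSimplex v s = activeSet (cutForm (simplexMatrix m)) 0 ''
      (polyhedron (cutForm (simplexMatrix m)) 0 \ {0}) := by
  ext J
  constructor
  · rintro ⟨x, hx, rfl⟩
    have hw := hv.coordEquiv.apply_symm_apply (x, 1)
    refine ⟨_, ⟨(hv.mem_cutSimplex_iff hm hs hw).1 hx, ?_⟩, (hv.cutActiveSet_eq hm hs hw).symm⟩
    exact (LinearEquiv.map_ne_zero_iff _).2 fun h => one_ne_zero (congrArg Prod.snd h)
  · rintro ⟨y, ⟨hy, hy0⟩, rfl⟩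
    obtain ⟨r, hr, x, hw⟩ := hv.exists_pos_coordEquiv_smul_eq hy0 hy
    refine ⟨x, (hv.mem_cutSimplex_iff hm hs hw).2 (smul_mem_polyhedron_zero hr.le hy), ?_⟩
    rw [hv.cutActiveSet_eq hm hs hw, activeSet_smul hr.ne']

end IsRegularSimplex

theorem isCombBitruncatedSimplex_of_form_eq {P : MirrorPolytope 4 FacetIdx}
    {M : Matrix (Fin 5) (Fin 5) ℝ} (hP : P.form = cutForm M) (hM : IsTripleNegative M)
    (hlt : ∀ i j, i ≠ j → M i j * M j i < 4) : IsCombBitruncatedSimplex P := by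
  intro v hv s hs₁ hs₂
  obtain ⟨m, hm₁, hm₂, hs⟩ : ∃ m : ℝ, 1 < m ∧ m < 2 ∧
      2 * s * (2 + m) = ‖v 0‖ * (2 * m - 1) := by
    have hpos : 0 < ‖v 0‖ - s := by linarith [hv.norm_pos 0]
    refine ⟨(4 * s + ‖v 0‖) / (2 * (‖v 0‖ - s)), ?_, ?_, ?_⟩
    · rw [lt_div_iff₀ (by positivity)]
      linarith
    · rw [div_lt_iff₀ (by positivity)]
      linarith
    · field_simp
      ring
  have hltm : ∀ i j, i ≠ j → simplexMatrix m i j * simplexMatrix m j i < 4 := fun i j h => by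
    rw [simplexMatrix_of_ne m h, simplexMatrix_of_ne m h.symm]
    nlinarith
  have hact : P.act '' P.carrier = cutActiveSet v s '' cutSimplex v s := by
    rw [P.act_image_carrier, hP, hM.image_activeSet_cutForm hlt,
      hv.image_cutActiveSet (one_pos.trans hm₁) hs,
      (isTripleNegative_simplexMatrix hm₁ hm₂.le).image_activeSet_cutForm hltm]
  exact ⟨activeFaceOrderIso hact P.isFace_iff (isExposed_cutSimplex_iff v s),
    fun k => transferFace_setOf hact (k ∈ ·)⟩

/-! ### The ideal rectified simplex -/

theorem exists_ne_of_sum_eq_one {ι : Type*} [Fintype ι] {w : ι → ℝ} (hsum : ∑ j, w j = 1) {i : ι}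
    (hi₀ : 0 < w i) (hi₁ : w i < 1 / 2) : ∃ j, j ≠ i ∧ w j ≠ 0 ∧ w j ≠ 1 / 2 := by
  classical
  by_contra! hhalf
  have hnat : ∀ j, ∃ n : ℕ, j ≠ i → w j = n / 2 := fun j => by
    by_cases hj : w j = 0
    · exact ⟨0, fun _ => by simp [hj]⟩
    · exact ⟨1, fun hji => by simpa using hhalf j hji hj⟩
  choose n hn using hnat
  rw [← Finset.add_sum_erase _ _ (Finset.mem_univ i),
    Finset.sum_congr rfl fun j hj => hn j (Finset.ne_of_mem_erase hj), ← Finset.sum_div,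
    ← Nat.cast_sum] at hsum
  have hlower : 1 < ∑ j ∈ Finset.univ.erase i, n j := by
    exact_mod_cast (by linarith : (1 : ℝ) < (∑ j ∈ Finset.univ.erase i, n j : ℕ))
  have hupper : ∑ j ∈ Finset.univ.erase i, n j < 2 := by
    exact_mod_cast (by linarith : ((∑ j ∈ Finset.univ.erase i, n j : ℕ) : ℝ) < 2)
  omega

namespace IsRegularSimplex

variable {v : Fin 5 → E4} {w : Vec 4} {x : E4}

theorem mem_cutSimplex_rectified_iff (hv : IsRegularSimplex v) (hw : hv.coordEquiv w = (x, 1)) :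
    x ∈ cutSimplex v (3 * ‖v 0‖ / 8) ↔ ∀ i, 0 ≤ w i ∧ w i ≤ 1 / 2 := by
  have hsum : ∑ j, w j = 1 := hv.sum_of_coordEquiv hw
  rw [hv.mem_cutSimplex_iff two_pos (by ring) hw, mem_polyhedron_cutForm, and_comm, forall_and]
  refine and_congr_right fun _ => forall_congr' fun i => ?_
  rw [simplexMatrix_mulVec, hsum]
  constructor <;> intro h <;> linarith

theorem apply_eq_zero_or_half_of_mem_extremePoints (hv : IsRegularSimplex v)
    (hx : x ∈ (cutSimplex v (3 * ‖v 0‖ / 8)).extremePoints ℝ) (hw : hv.coordEquiv w = (x, 1))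
    (i : Fin 5) : w i = 0 ∨ w i = 1 / 2 := by
  have hbound := (hv.mem_cutSimplex_rectified_iff hw).1 hx.1
  have hsum : ∑ j, w j = 1 := hv.sum_of_coordEquiv hw
  by_contra! hi
  obtain ⟨j, hji, hj⟩ := exists_ne_of_sum_eq_one hsum ((hbound i).1.lt_of_ne' hi.1)
    ((hbound i).2.lt_of_ne hi.2)
  -- The point can then be moved in the direction `v i - v j` without leaving any active facet.
  let d : Vec 4 := Pi.single i 1 - Pi.single j 1
  have hd : hv.coordEquiv d = ((hv.coordEquiv d).1, 0) := by
    refine Prod.ext rfl ?_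
    rw [coordEquiv_apply]
    simp [d]
  have hdk : ∀ k, w k = 0 ∨ w k = 1 / 2 → d k = 0 := fun k hk => by
    have hki : k ≠ i := fun h => hk.elim (h ▸ hi.1) (h ▸ hi.2)
    have hkj : k ≠ j := fun h => hk.elim (h ▸ hj.1) (h ▸ hj.2)
    simp [d, hki, hkj]
  have hdzero : (hv.coordEquiv d).1 = 0 := by
    rw [cutSimplex_eq_polyhedron] at hx
    refine eq_zero_of_mem_extremePoints_polyhedron hx fun k hk => ?_
    rw [← cutActiveSet_eq_activeSet, hv.cutActiveSet_eq two_pos (by ring) hw] at hk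
    rcases k with k | k
    · rw [inl_mem_activeSet_cutForm, simplexMatrix_mulVec, hsum] at hk
      change inner ℝ (v k) (hv.coordEquiv d).1 = 0
      rw [hv.inner_of_coordEquiv hd, hdk k (Or.inr (by linarith))]
      simp
    · rw [inr_mem_activeSet_cutForm] at hk
      change -inner ℝ (v k) (hv.coordEquiv d).1 = 0
      rw [hv.inner_of_coordEquiv hd, hdk k (Or.inl hk)]
      simp
  have hdi : d i = 1 := by simp [d, hji.symm]
  rw [hv.coordEquiv.map_eq_zero_iff.1 (hd.trans (by rw [hdzero]; rfl))] at hdi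
  exact zero_ne_one hdi

theorem extremePoints_rectified_subset_sphere (hv : IsRegularSimplex v) {r : ℝ}
    (hr₀ : 0 ≤ r) (hr : r ^ 2 = 3 * ‖v 0‖ ^ 2 / 8) :
    (cutSimplex v (3 * ‖v 0‖ / 8)).extremePoints ℝ ⊆ Metric.sphere 0 r := by
  intro x hx
  obtain ⟨w, hw⟩ := hv.coordEquiv.surjective (x, 1)
  have hterm : ∀ j, w j * inner ℝ (v j) x = 3 * ‖v 0‖ ^ 2 / 8 * w j := fun j => by
    rw [hv.inner_of_coordEquiv hw, hv.norm_eq j 0]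
    rcases hv.apply_eq_zero_or_half_of_mem_extremePoints hx hw j with h | h <;> rw [h] <;> ring
  have hsq : ‖x‖ ^ 2 = r ^ 2 := calc
    ‖x‖ ^ 2 = inner ℝ (∑ j, w j • v j) x := by
      rw [← real_inner_self_eq_norm_sq,
        show ∑ j, w j • v j = x from congrArg Prod.fst ((hv.coordEquiv_apply w).symm.trans hw)]
    _ = ∑ j, w j * inner ℝ (v j) x := by simp_rw [sum_inner, real_inner_smul_left]
    _ = r ^ 2 := by
      simp_rw [hterm, ← Finset.mul_sum, hv.sum_of_coordEquiv hw, mul_one, hr]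
  rw [mem_sphere_zero_iff_norm]
  exact (pow_left_inj₀ (norm_nonneg _) hr₀ two_ne_zero).1 hsq

theorem lorentz_coordEquiv (hv : IsRegularSimplex v) {r : ℝ} (hr : r ^ 2 = 3 * ‖v 0‖ ^ 2 / 8)
    (w w' : Vec 4) :
    lorentz r (hv.coordEquiv w) (hv.coordEquiv w') =
      5 / 4 * ‖v 0‖ ^ 2 * (w ⬝ᵥ w' - (∑ i, w i) * (∑ i, w' i) / 2) := by
  simp only [coordEquiv_apply, lorentz, hr, sum_inner, real_inner_smul_left, hv.inner_sum_smul,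
    hv.norm_eq _ 0]
  have hterm : ∀ j, w j * (‖v 0‖ ^ 2 * (5 / 4 * w' j - (∑ i, w' i) / 4)) =
      5 / 4 * ‖v 0‖ ^ 2 * (w j * w' j) - ‖v 0‖ ^ 2 * (∑ i, w' i) / 4 * w j := fun j => by ring
  simp_rw [hterm, Finset.sum_sub_distrib, ← Finset.mul_sum, dotProduct]
  ring

theorem setOf_act_eq_sphereImage (hv : IsRegularSimplex v) {P : MirrorPolytope 4 FacetIdx}
    {s m : ℝ} (hm : 0 < m) (hs : 2 * s * (2 + m) = ‖v 0‖ * (2 * m - 1))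
    (hP : P.form = cutForm (simplexMatrix m)) (p : Set FacetIdx → Prop) :
    {q ∈ P.carrier | p (P.act q)} =
      sphereImage {w | ∃ x ∈ {x ∈ cutSimplex v s | p (cutActiveSet v s x)},
        hv.coordEquiv w = (x, 1)} := by
  ext q
  constructor
  · obtain ⟨y, rfl⟩ := toSphere_surjective q
    rintro ⟨hy, hp⟩
    rw [MirrorPolytope.toSphere_mem_carrier, hP] at hy
    rw [P.act_toSphere, hP] at hp
    obtain ⟨r, hr, x, hw⟩ := hv.exists_pos_coordEquiv_smul_eq y.2 hy
    refine ⟨⟨r • y.1, smul_ne_zero hr.ne' y.2⟩, ⟨x, ⟨?_, ?_⟩, hw⟩, ray_pos_smul y.2 hr _⟩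
    · exact (hv.mem_cutSimplex_iff hm hs hw).2 (smul_mem_polyhedron_zero hr.le hy)
    · rwa [hv.cutActiveSet_eq hm hs hw, activeSet_smul hr.ne']
  · rintro ⟨w, ⟨x, ⟨hx, hp⟩, hw⟩, rfl⟩
    refine ⟨MirrorPolytope.toSphere_mem_carrier.2 ?_, ?_⟩
    · rw [hP]
      exact (hv.mem_cutSimplex_iff hm hs hw).1 hx
    · rwa [P.act_toSphere, hP, ← hv.cutActiveSet_eq hm hs hw]

end IsRegularSimplex

theorem lorentz_refl (P : MirrorPolytope 4 FacetIdx) {k : FacetIdx} {r c : ℝ}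
    (g : Vec 4 →ₗ[ℝ] E4 × ℝ) (h : ∀ u, lorentz r (g (P.vec k)) (g u) = c * P.form k u)
    (w w' : Vec 4) :
    lorentz r (g (P.refl k w)) (g (P.refl k w')) = lorentz r (g w) (g w') := by
  have hrefl : ∀ u, g (P.refl k u) = g u - P.form k u • g (P.vec k) := fun u => by
    rw [MirrorPolytope.refl, Module.reflection_apply, map_sub, map_smul]
  have hsub : ∀ (p q b : E4 × ℝ) (a a' : ℝ), lorentz r (p - a • b) (q - a' • b) =
      lorentz r p q - a' * lorentz r b p - a * lorentz r b q + a * a' * lorentz r b b := by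
    intro p q b a a'
    simp only [lorentz, Prod.fst_sub, Prod.snd_sub, Prod.smul_fst, Prod.smul_snd, inner_sub_left,
      inner_sub_right, real_inner_smul_left, real_inner_smul_right, smul_eq_mul,
      real_inner_comm p.1 b.1]
    ring
  rw [hrefl, hrefl, hsub, h, h, h, P.form_vec]
  ring

theorem isIdealHyperbolicRectifiedSimplex_of_form_eq {P : MirrorPolytope 4 FacetIdx}
    (hP : P.form = cutForm (simplexMatrix 2)) (hinl : ∀ j, P.vec (Sum.inl j) = Pi.single j 2)
    (hinr : ∀ j, P.vec (Sum.inr j) = 1 - Pi.single j 3) :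
    IsIdealHyperbolicRectifiedSimplex P := by
  intro v hv
  have hnorm := hv.norm_pos 0
  have hr : √(3 * ‖v 0‖ ^ 2 / 8) ^ 2 = 3 * ‖v 0‖ ^ 2 / 8 := Real.sq_sqrt (by positivity)
  have hs : 2 * (3 * ‖v 0‖ / 8) * (2 + 2) = ‖v 0‖ * (2 * 2 - 1) := by ring
  refine ⟨√(3 * ‖v 0‖ ^ 2 / 8), by positivity,
    hv.extremePoints_rectified_subset_sphere (Real.sqrt_nonneg _) hr, hv.coordEquiv, ?_, ?_, ?_⟩
  · simpa using hv.setOf_act_eq_sphereImage two_pos hs hP fun _ => True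
  · exact fun k => hv.setOf_act_eq_sphereImage two_pos hs hP (k ∈ ·)
  · rintro (j | j) w w'
    · refine lorentz_refl P hv.coordEquiv.toLinearMap
        (c := 5 / 4 * ‖v 0‖ ^ 2) (fun u => ?_) w w'
      simp only [LinearEquiv.coe_coe, hv.lorentz_coordEquiv hr, hinl, hP, cutForm_inl,
        simplexMatrix_mulVec, single_dotProduct, Finset.sum_pi_single', Finset.mem_univ, if_true]
      ring
    · refine lorentz_refl P hv.coordEquiv.toLinearMap
        (c := 15 / 4 * ‖v 0‖ ^ 2) (fun u => ?_) w w'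
      simp only [LinearEquiv.coe_coe, hv.lorentz_coordEquiv hr, hinr, hP, cutForm_inr,
        sub_dotProduct, one_dotProduct, single_dotProduct, Pi.sub_apply, Pi.one_apply,
        Finset.sum_sub_distrib, Finset.sum_pi_single', Finset.mem_univ, if_true,
        Finset.sum_const, Finset.card_univ, Fintype.card_fin, nsmul_eq_mul]
      ring

/-! ### The function `f` and the angle -/

section AddOneDiv

variable {K : Type*} [Field K] [LinearOrder K] [IsStrictOrderedRing K]

theorem two_le_add_one_div {t : K} (ht : 0 < t) : 2 ≤ t + 1 / t := by
  have hsub : t + 1 / t - 2 = (t - 1) ^ 2 / t := by field_simp; ring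
  have hnonneg : 0 ≤ (t - 1) ^ 2 / t := by positivity
  linarith

theorem strictAntiOn_add_one_div : StrictAntiOn (fun t : K => t + 1 / t) (Ioc 0 1) := by
  intro s hs t ht hst
  have hs₀ : 0 < s := hs.1
  have ht₀ : 0 < t := ht.1
  have hsub : s + 1 / s - (t + 1 / t) = (t - s) * (1 - s * t) / (s * t) := by
    field_simp
    ring
  have hst₁ : s * t < 1 := (mul_lt_of_lt_one_left ht₀ (hst.trans_le ht.2)).trans_le ht.2
  have hpos : 0 < (t - s) * (1 - s * t) / (s * t) :=
    div_pos (mul_pos (sub_pos.2 hst) (sub_pos.2 hst₁)) (mul_pos hs₀ ht₀)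
  exact sub_pos.1 (hsub ▸ hpos)

end AddOneDiv

section Angle

variable {t : ℝ}

/- The numerator and the denominator of `f` are palindromic, so `f` is a function of `t + 1 / t`;
it is written as a product of two decreasing ones. -/
theorem fFun_eq (ht : 0 < t) :
    fFun t = ((2 * (t + 1 / t) + 5) / (t + 1 / t + 1)) ^ 2 *
      ((2 * (t + 1 / t) + 5) / (t + 1 / t + 7) ^ 2) := by
  have hden : t + 1 / t + 1 = (t ^ 2 + t + 1) / t := by field_simp; ring
  have hden' : t + 1 / t + 7 = (t ^ 2 + 7 * t + 1) / t := by field_simp; ring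
  have hnum : 2 * (t + 1 / t) + 5 = (t + 2) * (2 * t + 1) / t := by field_simp; ring
  rw [hden, hden', hnum, fFun]
  field_simp

theorem fFun_strictMonoOn : StrictMonoOn fFun (Ioc 0 1) := by
  intro s hs t ht hst
  rw [fFun_eq hs.1, fFun_eq ht.1]
  have hxy : t + 1 / t < s + 1 / s := strictAntiOn_add_one_div hs ht hst
  have hx := two_le_add_one_div ht.1
  set x := t + 1 / t
  set y := s + 1 / s
  have hlt : (2 * y + 5) / (y + 1) < (2 * x + 5) / (x + 1) := by
    rw [div_lt_div_iff₀ (by linarith) (by linarith)]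
    linarith
  have hle : (2 * y + 5) / (y + 7) ^ 2 ≤ (2 * x + 5) / (x + 7) ^ 2 := by
    rw [div_le_div_iff₀ (by nlinarith) (by nlinarith)]
    have hnonneg : 0 ≤ (y - x) * (2 * x * y + 5 * (x + y) - 28) :=
      mul_nonneg (by linarith) (by nlinarith)
    linarith
  have hpos : 0 < (2 * y + 5) / (y + 1) := div_pos (by linarith) (by linarith)
  have hpos' : 0 < (2 * x + 5) / (x + 7) ^ 2 := div_pos (by linarith) (by nlinarith)
  calc ((2 * y + 5) / (y + 1)) ^ 2 * ((2 * y + 5) / (y + 7) ^ 2)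
      ≤ ((2 * y + 5) / (y + 1)) ^ 2 * ((2 * x + 5) / (x + 7) ^ 2) := by gcongr
    _ < ((2 * x + 5) / (x + 1)) ^ 2 * ((2 * x + 5) / (x + 7) ^ 2) :=
      mul_lt_mul_of_pos_right (pow_lt_pow_left₀ hlt hpos.le two_ne_zero) hpos'

theorem fFun_pos (ht : 0 < t) : 0 < fFun t := by
  unfold fFun
  positivity

theorem fFun_one : fFun 1 = 1 := by norm_num [fFun]

theorem tThree_pos : 0 < tThree := by
  have hsqrt : 3 * √(31 + 22 * √2) < 11 + 9 * √2 := by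
    refine lt_of_pow_lt_pow_left₀ 2 (by positivity) ?_
    rw [mul_pow, sq_sqrt (by positivity), add_sq, mul_pow 9, sq_sqrt zero_le_two]
    linarith
  unfold tThree
  linarith

theorem tThree_lt_one : tThree < 1 := by
  have hsqrt : 9 + 9 * √2 < 3 * √(31 + 22 * √2) := by
    refine lt_of_pow_lt_pow_left₀ 2 (by positivity) ?_
    rw [mul_pow, sq_sqrt (by positivity), add_sq, mul_pow 9, sq_sqrt zero_le_two]
    linarith [sqrt_nonneg 2]
  unfold tThree
  linarith

theorem tThree_add_one_div : tThree + 1 / tThree = 11 + 9 * √2 := by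
  have htwo : √2 ^ 2 = 2 := sq_sqrt zero_le_two
  have hsqrt : √(31 + 22 * √2) ^ 2 = 31 + 22 * √2 := sq_sqrt (by positivity)
  have hquad : tThree ^ 2 + 1 = (11 + 9 * √2) * tThree := by
    unfold tThree
    linear_combination 9 / 4 * hsqrt - 81 / 4 * htwo
  have hpos := tThree_pos
  field_simp
  rw [hquad, mul_comm]

theorem fFun_tThree : fFun tThree = 1 / 4 := by
  have htwo : √2 ^ 2 = 2 := sq_sqrt zero_le_two
  have hnum : 2 * (11 + 9 * √2) + 5 = 9 * (1 + √2) ^ 2 := by linear_combination -9 * htwo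
  have hden : (11 + 9 * √2 + 1) * (11 + 9 * √2 + 7) = 54 * (1 + √2) ^ 3 := by
    linear_combination (81 - 162 - 54 * √2) * htwo
  rw [fFun_eq tThree_pos, tThree_add_one_div, div_pow, div_mul_div_comm,
    div_eq_div_iff (by positivity) (by norm_num), hnum, ← mul_pow, hden]
  ring

theorem pos_of_mem_Icc_tThree (ht : t ∈ Icc tThree 1) : 0 < t := tThree_pos.trans_le ht.1

theorem fFun_mem_Icc (ht : t ∈ Icc tThree 1) : fFun t ∈ Icc (1 / 4) 1 := by
  have hmono := fFun_strictMonoOn.monotoneOn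
  have ht₀ := pos_of_mem_Icc_tThree ht
  rw [← fFun_tThree, ← fFun_one]
  exact ⟨hmono ⟨tThree_pos, tThree_lt_one.le⟩ ⟨ht₀, ht.2⟩ ht.1,
    hmono ⟨ht₀, ht.2⟩ ⟨one_pos, le_rfl⟩ ht.2⟩

/-- The quotient of `1 - f` by `(1 - t)²`. It is positive, also at `t = 1`, so that `√(1 - f)`
is analytic on the closed interval. -/
def angleFactor (t : ℝ) : ℝ :=
  ((t + 1 / t) ^ 3 + 10 * (t + 1 / t) ^ 2 + 38 * (t + 1 / t) + 38) /
    (t * ((t + 1 / t + 1) * (t + 1 / t + 7)) ^ 2)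

theorem angleFactor_pos (ht : 0 < t) : 0 < angleFactor t := by
  unfold angleFactor
  positivity

theorem one_sub_fFun (ht : 0 < t) : 1 - fFun t = (1 - t) ^ 2 * angleFactor t := by
  have hsq : (1 - t) ^ 2 / t = t + 1 / t - 2 := by field_simp; ring
  have hfactor : (1 - t) ^ 2 * angleFactor t = (t + 1 / t - 2) *
      (((t + 1 / t) ^ 3 + 10 * (t + 1 / t) ^ 2 + 38 * (t + 1 / t) + 38) /
        (((t + 1 / t + 1) * (t + 1 / t + 7)) ^ 2)) := by
    rw [← hsq, angleFactor]
    field_simp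
  rw [fFun_eq ht, hfactor]
  have htwo := two_le_add_one_div ht
  generalize t + 1 / t = x at htwo
  have hone : x + 1 ≠ 0 := by linarith
  have hseven : x + 7 ≠ 0 := by linarith
  field_simp
  ring

/-- The angle `α(t)`, that is `arccos √f = arcsin √(1 - f)`, written so as to be visibly
analytic at `t = 1`. -/
def angle (t : ℝ) : ℝ := arcsin ((1 - t) * √(angleFactor t))

theorem mul_sqrt_angleFactor (ht : 0 < t) (ht₁ : t ≤ 1) :
    (1 - t) * √(angleFactor t) = √(1 - fFun t) := by
  rw [one_sub_fFun ht, sqrt_mul (sq_nonneg _), sqrt_sq (by linarith)]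

theorem angle_eq (ht : 0 < t) (ht₁ : t ≤ 1) : angle t = arcsin √(1 - fFun t) := by
  rw [angle, mul_sqrt_angleFactor ht ht₁]

theorem sqrt_one_sub_fFun_mem_Ico (ht : 0 < t) : √(1 - fFun t) ∈ Ico 0 1 := by
  refine ⟨sqrt_nonneg _, ?_⟩
  rw [sqrt_lt' one_pos]
  linarith [fFun_pos ht]

theorem analyticAt_angleFactor (ht : 0 < t) : AnalyticAt ℝ angleFactor t := by
  have hinv : AnalyticAt ℝ (fun t : ℝ => 1 / t) t :=
    analyticAt_const.div analyticAt_id ht.ne'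
  unfold angleFactor
  refine AnalyticAt.div (by fun_prop) (by fun_prop) ?_
  positivity

theorem analyticAt_angle (ht : t ∈ Icc tThree 1) : AnalyticAt ℝ angle t := by
  have ht₀ := pos_of_mem_Icc_tThree ht
  have hsqrt : AnalyticAt ℝ (fun t => √(angleFactor t)) t :=
    (contDiffAt_sqrt (angleFactor_pos ht₀).ne').analyticAt.fun_comp (analyticAt_angleFactor ht₀)
  have hmem := sqrt_one_sub_fFun_mem_Ico ht₀
  rw [← mul_sqrt_angleFactor ht₀ ht.2] at hmem
  have harcsin : AnalyticAt ℝ arcsin ((1 - t) * √(angleFactor t)) :=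
    (contDiffAt_arcsin (by linarith [hmem.1]) hmem.2.ne).analyticAt
  have hmul : AnalyticAt ℝ (fun t => (1 - t) * √(angleFactor t)) t :=
    (analyticAt_const.sub analyticAt_id).mul hsqrt
  exact AnalyticAt.fun_comp (f := fun t => (1 - t) * √(angleFactor t)) harcsin hmul

theorem cos_angle_sq (ht : t ∈ Icc tThree 1) : cos (angle t) ^ 2 = fFun t := by
  have ht₀ := pos_of_mem_Icc_tThree ht
  have hmem := sqrt_one_sub_fFun_mem_Ico ht₀
  rw [cos_sq', angle_eq ht₀ ht.2, sin_arcsin (by linarith [hmem.1]) hmem.2.le,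
    sq_sqrt (by linarith [(fFun_mem_Icc ht).2])]
  ring

theorem angle_strictAntiOn : StrictAntiOn angle (Icc tThree 1) := by
  intro s hs t ht hst
  have hs₀ := pos_of_mem_Icc_tThree hs
  have ht₀ := pos_of_mem_Icc_tThree ht
  rw [angle_eq hs₀ hs.2, angle_eq ht₀ ht.2]
  have hmem : ∀ {u : ℝ}, 0 < u → √(1 - fFun u) ∈ Icc (-1) 1 := fun hu =>
    Icc_subset_Icc_left (by norm_num) (Ico_subset_Icc_self (sqrt_one_sub_fFun_mem_Ico hu))
  refine strictMonoOn_arcsin (hmem ht₀) (hmem hs₀)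
    (sqrt_lt_sqrt (by linarith [(fFun_mem_Icc ht).2]) ?_)
  linarith [fFun_strictMonoOn ⟨hs₀, hs.2⟩ ⟨ht₀, ht.2⟩ hst]

theorem angle_tThree : angle tThree = π / 3 := by
  have hsin : √(1 - 1 / 4) = sin (π / 3) := by
    rw [sin_pi_div_three, show (1 - 1 / 4 : ℝ) = 3 / 2 ^ 2 by norm_num,
      sqrt_div' _ (by positivity), sqrt_sq zero_le_two]
  rw [angle_eq tThree_pos tThree_lt_one.le, fFun_tThree, hsin]
  exact arcsin_sin (by linarith [pi_pos]) (by linarith [pi_pos])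

theorem angle_one : angle 1 = 0 := by simp [angle]

theorem angle_mem_Icc (ht : t ∈ Icc tThree 1) : angle t ∈ Icc 0 (π / 3) := by
  rw [← angle_one, ← angle_tThree]
  exact ⟨angle_strictAntiOn.antitoneOn ht ⟨tThree_lt_one.le, le_rfl⟩ ht.2,
    angle_strictAntiOn.antitoneOn ⟨le_rfl, tThree_lt_one.le⟩ ht ht.1⟩

theorem exists_angle_eq {x : ℝ} (hx : x ∈ Icc 0 (π / 3)) : ∃ t ∈ Icc tThree 1, angle t = x := by
  have hcont : ContinuousOn angle (Icc tThree 1) := fun t ht =>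
    (analyticAt_angle ht).continuousAt.continuousWithinAt
  have hsubset := intermediate_value_Icc' tThree_lt_one.le hcont
  rw [angle_one, angle_tThree] at hsubset
  exact hsubset hx

/-- The angle as a homeomorphism; the inverse reparametrizes the path by the angle. -/
def angleHomeomorph : Icc tThree 1 ≃ₜ Icc (0 : ℝ) (π / 3) :=
  Continuous.homeoOfEquivCompactToT2
    (f := Equiv.ofBijective (fun t : Icc tThree 1 => (⟨angle t, angle_mem_Icc t.2⟩ : Icc 0 (π / 3)))
      ⟨fun s t h => Subtype.ext (angle_strictAntiOn.injOn s.2 t.2 (Subtype.mk.inj h)),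
        fun x =>
          let ⟨t, ht, h⟩ := exists_angle_eq x.2
          ⟨⟨t, ht⟩, Subtype.ext h⟩⟩)
    (Continuous.subtype_mk (continuous_iff_continuousAt.2 fun t =>
      (analyticAt_angle t.2).continuousAt.comp continuousAt_subtype_val) _)

theorem coe_angleHomeomorph (t : Icc tThree 1) : (angleHomeomorph t : ℝ) = angle t := rfl

/-- The parameter at which the angle takes a given value; outside of `[0, π / 3]` the value is
first projected to this interval. -/
def angleInv (α : ℝ) : Icc tThree 1 :=
  angleHomeomorph.symm (projIcc 0 (π / 3) (by positivity) α)

theorem continuous_angleInv : Continuous angleInv :=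
  angleHomeomorph.symm.continuous.comp continuous_projIcc

theorem angle_angleInv {α : ℝ} (hα : α ∈ Icc 0 (π / 3)) : angle (angleInv α) = α := by
  rw [← coe_angleHomeomorph, angleInv, Homeomorph.apply_symm_apply, projIcc_of_mem _ hα]

theorem angleInv_angle (t : Icc tThree 1) : angleInv (angle t) = t := by
  rw [angleInv, projIcc_of_mem _ (angle_mem_Icc t.2)]
  exact angleHomeomorph.symm_apply_apply t

end Angle

/-! ### The Cartan matrices `C_t` -/

theorem eq_zero_of_vecMul_neg {S : Type*} [Fintype S] {C : Matrix S S ℝ} {w x : S → ℝ}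
    (hw : ∀ i, 0 < w i) (hwC : ∀ i, C.vecMul w i < 0) (hCx : ∀ i, 0 ≤ C.mulVec x i)
    (hx : ∀ i, 0 ≤ x i) : x = 0 := by
  have hnonneg : 0 ≤ w ⬝ᵥ C.mulVec x :=
    Finset.sum_nonneg fun i _ => mul_nonneg (hw i).le (hCx i)
  rw [Matrix.dotProduct_mulVec] at hnonneg
  have hterm : ∀ i ∈ Finset.univ, C.vecMul w i * x i ≤ 0 := fun i _ =>
    mul_nonpos_of_nonpos_of_nonneg (hwC i).le (hx i)
  have hzero := (Finset.sum_eq_zero_iff_of_nonpos hterm).1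
    (le_antisymm (Finset.sum_nonpos hterm) hnonneg)
  funext i
  exact (mul_eq_zero.1 (hzero i (Finset.mem_univ i))).resolve_left (hwC i).ne

theorem isNegativeType_of_exists {S : Type} [Fintype S] {C : Matrix S S ℝ}
    (h : ∃ y : S → ℝ, (∀ i, 0 < y i) ∧ ∀ i, C.mulVec y i < 0)
    (h' : ∃ w : S → ℝ, (∀ i, 0 < w i) ∧ ∀ i, C.transpose.mulVec w i < 0) : IsNegativeType C := by
  obtain ⟨w, hw, hCw⟩ := h'
  simp only [Matrix.mulVec_transpose] at hCw
  exact ⟨h, fun x hCx hx => eq_zero_of_vecMul_neg hw hCw hCx hx⟩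

theorem exists_pos_fromBlocks_mulVec_neg {ι : Type*} [Fintype ι] [DecidableEq ι]
    {M : Matrix ι ι ℝ} {a b : ℝ} (N : Matrix ι ι ℝ) (ha : 0 < a) (hb : 0 < b)
    (hM : ∃ y : ι → ℝ, (∀ i, 0 < y i) ∧ ∀ i, M.mulVec y i < 0) :
    ∃ z : ι ⊕ ι → ℝ, (∀ i, 0 < z i) ∧ ∀ i, (Matrix.fromBlocks M (Matrix.diagonal fun _ => -a)
      (Matrix.diagonal fun _ => -b) N).mulVec z i < 0 := by
  obtain ⟨y, hy, hMy⟩ := hM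
  have hsmall : ∀ i, ∀ᶠ δ in nhdsWithin (0 : ℝ) (Ioi 0), δ * N.mulVec 1 i < b * y i := fun i => by
    have hlim : Filter.Tendsto (fun δ => δ * N.mulVec 1 i) (nhdsWithin (0 : ℝ) (Ioi 0))
        (nhds 0) := by
      simpa using ((continuous_id.mul continuous_const).tendsto (0 : ℝ)).mono_left
        nhdsWithin_le_nhds (f := fun δ => δ * N.mulVec 1 i)
    exact hlim.eventually_lt_const (mul_pos hb (hy i))
  obtain ⟨δ, hδ, hpos⟩ := ((Filter.eventually_all.2 hsmall).and self_mem_nhdsWithin).exists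
  refine ⟨Sum.elim y (δ • 1), ?_, ?_⟩
  · rintro (i | i)
    · exact hy i
    · simpa using hpos
  · rw [Matrix.fromBlocks_mulVec]
    rintro (i | i)
    · have hneg := mul_pos ha hpos
      simp only [Sum.elim_comp_inl, Sum.elim_comp_inr, Sum.elim_inl, Pi.add_apply,
        Matrix.mulVec_diagonal, Pi.smul_apply, Pi.one_apply, smul_eq_mul, mul_one]
      linarith [hMy i]
    · simp only [Sum.elim_comp_inl, Sum.elim_comp_inr, Sum.elim_inr, Pi.add_apply,
        Matrix.mulVec_diagonal, Matrix.mulVec_smul, Pi.smul_apply, smul_eq_mul]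
      linarith [hδ i]

theorem isNegativeType_fromBlocks {ι : Type} [Fintype ι] [DecidableEq ι] {M : Matrix ι ι ℝ}
    {a b : ℝ} (N : Matrix ι ι ℝ) (ha : 0 < a) (hb : 0 < b) (hM : IsTripleNegative M)
    (hι : 3 ≤ Nat.card ι) : IsNegativeType (Matrix.fromBlocks M (Matrix.diagonal fun _ => -a)
      (Matrix.diagonal fun _ => -b) N) := by
  refine isNegativeType_of_exists
    (exists_pos_fromBlocks_mulVec_neg N ha hb (hM.exists_pos_mulVec_neg hι)) ?_
  rw [Matrix.fromBlocks_transpose, Matrix.diagonal_transpose, Matrix.diagonal_transpose]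
  exact exists_pos_fromBlocks_mulVec_neg _ hb ha (hM.transpose.exists_pos_mulVec_neg hι)

section CartanMatrix

variable {t : ℝ}

/-- The block of `C_t` indexed by the facets `F'_i`. -/
def upperBlock (t : ℝ) : Matrix (Fin 5) (Fin 5) ℝ := (cMatrix t).toBlocks₁₁

/-- The block of `C_t` indexed by the facets `F_i`. -/
def lowerBlock (t : ℝ) : Matrix (Fin 5) (Fin 5) ℝ := (cMatrix t).toBlocks₂₂

theorem cMatrix_eq (t : ℝ) : cMatrix t = Matrix.fromBlocks (upperBlock t)
    (Matrix.diagonal fun _ => -hFun t) (Matrix.diagonal fun _ => -2) (lowerBlock t) := rfl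

theorem cMatrix_inl_inl (t : ℝ) (i j : Fin 5) :
    cMatrix t (Sum.inl i) (Sum.inl j) = upperBlock t i j := rfl

theorem cMatrix_inl_inr (t : ℝ) (i j : Fin 5) :
    cMatrix t (Sum.inl i) (Sum.inr j) = if i = j then -hFun t else 0 := by
  rw [cMatrix_eq, Matrix.fromBlocks_apply₁₂, Matrix.diagonal_apply]

theorem cMatrix_inr_inl (t : ℝ) (i j : Fin 5) :
    cMatrix t (Sum.inr i) (Sum.inl j) = if i = j then -2 else 0 := by
  rw [cMatrix_eq, Matrix.fromBlocks_apply₂₁, Matrix.diagonal_apply]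

theorem cMatrix_inr_inr (t : ℝ) (i j : Fin 5) :
    cMatrix t (Sum.inr i) (Sum.inr j) = lowerBlock t i j := rfl

/-- The ratio `g_{p + 1} / g_p`, which does not depend on `p`; its powers are the diagonal entries
of the matrix that conjugates the upper block to a matrix `stepMatrix`. -/
def gRatio (t : ℝ) : ℝ := t * (t + 2) / (2 * t + 1)

/-- The negative of the entries above the diagonal of the conjugated upper block. -/
def highFactor (t : ℝ) : ℝ :=
  2 * t ^ 2 * (t + 2) ^ 4 / ((t ^ 2 + t + 1) * (t ^ 2 + 7 * t + 1) * (2 * t + 1))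

/-- The negative of the entries below the diagonal of the conjugated upper block. -/
def lowFactor (t : ℝ) : ℝ :=
  2 * (2 * t + 1) ^ 4 / ((t ^ 2 + t + 1) * (t ^ 2 + 7 * t + 1) * (t * (t + 2)))

theorem upperBlock_eq (ht : 0 < t) : upperBlock t = Matrix.of fun i j : Fin 5 =>
    stepMatrix (highFactor t) (lowFactor t) i j * (gRatio t ^ (i : ℕ) / gRatio t ^ (j : ℕ)) := by
  have hne₁ : 2 * t + 1 ≠ 0 := by positivity
  have hne₂ : t + 2 ≠ 0 := by positivity
  ext i j
  fin_cases i <;> fin_cases j <;>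
    simp [upperBlock, cMatrix, gBarFun, gFun, fFun, stepMatrix, highFactor, lowFactor, gRatio,
      Matrix.toBlocks₁₁, ht.ne', hne₁, hne₂] <;> field_simp <;> norm_num

theorem lowerBlock_eq (t : ℝ) : lowerBlock t = stepMatrix (1 / t) t := by
  ext i j
  fin_cases i <;> fin_cases j <;> simp [lowerBlock, cMatrix, stepMatrix, Matrix.toBlocks₂₂]

theorem upperBlock_mul_lowerBlock (ht : 0 < t) :
    upperBlock t * lowerBlock t = Matrix.diagonal fun _ => 2 * hFun t := by
  have hne₁ : 2 * t + 1 ≠ 0 := by positivity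
  have hne₂ : t + 2 ≠ 0 := by positivity
  ext i j
  fin_cases i <;> fin_cases j <;>
    simp [Matrix.mul_apply, Fin.sum_univ_five, upperBlock_eq ht, lowerBlock_eq, stepMatrix,
      highFactor, lowFactor, gRatio, hFun, ht.ne', hne₁, hne₂] <;> field_simp <;> ring

theorem gRatio_pos (ht : 0 < t) : 0 < gRatio t := by
  unfold gRatio
  positivity

theorem hFun_pos (ht : 0 < t) : 0 < hFun t := by
  unfold hFun
  positivity

theorem highFactor_pos (ht : 0 < t) : 0 < highFactor t := by
  unfold highFactor
  positivity

theorem highFactor_mul_lowFactor (ht : 0 < t) : highFactor t * lowFactor t = 4 * fFun t := by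
  unfold highFactor lowFactor fFun
  field_simp
  ring

theorem two_le_lowFactor (ht : 0 < t) (ht₁ : t ≤ 1) : 2 ≤ lowFactor t := by
  have hdiff : 2 * (2 * t + 1) ^ 4 - 2 * ((t ^ 2 + t + 1) * (t ^ 2 + 7 * t + 1) * (t * (t + 2))) =
      2 * ((1 - t) * (1 + 7 * t + 14 * t ^ 2 + 20 * t ^ 3 + 11 * t ^ 4 + t ^ 5)) := by
    ring
  unfold lowFactor
  rw [le_div_iff₀ (by positivity), ← sub_nonneg, hdiff]
  exact mul_nonneg zero_le_two (mul_nonneg (sub_nonneg.2 ht₁) (by positivity))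

theorem isTripleNegative_upperBlock (ht : t ∈ Icc tThree 1) : IsTripleNegative (upperBlock t) := by
  have ht₀ := pos_of_mem_Icc_tThree ht
  have hf := fFun_mem_Icc ht
  have hhigh := highFactor_pos ht₀
  have hlow := two_le_lowFactor ht₀ ht.2
  rw [upperBlock_eq ht₀]
  refine IsTripleNegative.conj (d := fun i : Fin 5 => gRatio t ^ (i : ℕ))
    (isTripleNegative_stepMatrix hhigh (by linarith) ?_ ?_) fun i => pow_pos (gRatio_pos ht₀) i
  · rw [highFactor_mul_lowFactor ht₀]
    linarith [hf.2]
  · rw [highFactor_mul_lowFactor ht₀]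
    nlinarith [hf.1]

theorem upperBlock_mul_apply (ht : 0 < t) {i j : Fin 5} (hij : i ≠ j) :
    upperBlock t i j * upperBlock t j i = 4 * fFun t := by
  have hi := (pow_pos (gRatio_pos ht) i).ne'
  have hj := (pow_pos (gRatio_pos ht) j).ne'
  rw [← highFactor_mul_lowFactor ht, ← stepMatrix_mul_stepMatrix (a := highFactor t) hij,
    upperBlock_eq ht, Matrix.of_apply, Matrix.of_apply, mul_mul_mul_comm, div_mul_div_comm,
    mul_comm (gRatio t ^ (j : ℕ)), div_self (mul_ne_zero hi hj), mul_one]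

theorem lowerBlock_mul_apply (ht : t ≠ 0) {i j : Fin 5} (hij : i ≠ j) :
    lowerBlock t i j * lowerBlock t j i = 1 := by
  rw [lowerBlock_eq, stepMatrix_mul_stepMatrix hij, one_div_mul_cancel ht]

theorem lowerBlock_neg (ht : 0 < t) {i j : Fin 5} (hij : i ≠ j) : lowerBlock t i j < 0 := by
  rw [lowerBlock_eq, stepMatrix_of_ne _ _ hij, neg_lt_zero]
  split_ifs
  · exact one_div_pos.2 ht
  · exact ht

theorem cMatrix_neg_or_zero (ht : t ∈ Icc tThree 1) {s s' : FacetIdx} (hs : s ≠ s') :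
    (cMatrix t s s' < 0 ∧ cMatrix t s' s < 0) ∨ (cMatrix t s s' = 0 ∧ cMatrix t s' s = 0) := by
  have ht₀ := pos_of_mem_Icc_tThree ht
  have hupper := (isTripleNegative_upperBlock ht).neg
  have hh := neg_lt_zero.2 (hFun_pos ht₀)
  have htwo : (-2 : ℝ) < 0 := by norm_num
  rcases s with i | i <;> rcases s' with j | j
  · rw [Ne, Sum.inl.injEq] at hs
    exact Or.inl ⟨hupper i j hs, hupper j i (Ne.symm hs)⟩
  · rw [cMatrix_inl_inr, cMatrix_inr_inl]
    rcases eq_or_ne i j with rfl | hij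
    · exact Or.inl ⟨by rwa [if_pos rfl], by rwa [if_pos rfl]⟩
    · exact Or.inr ⟨if_neg hij, if_neg hij.symm⟩
  · rw [cMatrix_inl_inr, cMatrix_inr_inl]
    rcases eq_or_ne i j with rfl | hij
    · exact Or.inl ⟨by rwa [if_pos rfl], by rwa [if_pos rfl]⟩
    · exact Or.inr ⟨if_neg hij, if_neg hij.symm⟩
  · rw [Ne, Sum.inr.injEq] at hs
    exact Or.inl ⟨lowerBlock_neg ht₀ hs, lowerBlock_neg ht₀ (Ne.symm hs)⟩

theorem cMatrix_self (ht : t ∈ Icc tThree 1) (s : FacetIdx) : cMatrix t s s = 2 := by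
  rcases s with i | i
  · rw [cMatrix_inl_inl, (isTripleNegative_upperBlock ht).diag]
  · rw [cMatrix_inr_inr, lowerBlock_eq, stepMatrix_self]

theorem isCartanMatrix_cMatrix (ht : t ∈ Icc tThree 1) : IsCartanMatrix (cMatrix t) := by
  refine ⟨cMatrix_self ht, fun s s' h => ?_, fun s s' h => ?_⟩
  · exact (cMatrix_neg_or_zero ht h).elim (fun h => h.1.le) fun h => h.1.le
  · exact (cMatrix_neg_or_zero ht h).elim (fun h => iff_of_false h.1.ne h.2.ne)
      fun h => iff_of_true h.1 h.2

theorem isIndecomposable_cMatrix (ht : t ∈ Icc tThree 1) : IsIndecomposable (cMatrix t) := by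
  rintro ⟨T, ⟨s, hs⟩, ⟨s', hs'⟩, hT⟩
  have hmem : ∀ {s s'}, cMatrix t s s' ≠ 0 → s ∈ T → s' ∈ T := fun hne hs => by
    by_contra hs'
    exact hne (hT _ hs _ hs').1
  have hinr : ∀ i, Sum.inr i ∈ T ↔ Sum.inl i ∈ T := fun i =>
    ⟨hmem (by simp [cMatrix_inr_inl]),
      hmem (by simpa [cMatrix_inl_inr] using (hFun_pos (pos_of_mem_Icc_tThree ht)).ne')⟩
  have hinl : ∀ i j, Sum.inl i ∈ T → Sum.inl j ∈ T := fun i j => by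
    rcases eq_or_ne i j with rfl | hij
    · exact id
    · exact hmem ((isTripleNegative_upperBlock ht).neg i j hij).ne
  have hrep : ∀ s : FacetIdx, ∃ i, s ∈ T ↔ Sum.inl i ∈ T := by
    rintro (i | i)
    exacts [⟨i, Iff.rfl⟩, ⟨i, hinr i⟩]
  obtain ⟨i, hi⟩ := hrep s
  obtain ⟨j, hj⟩ := hrep s'
  exact hs' (hj.2 (hinl i j (hi.1 hs)))

theorem isNegativeType_cMatrix (ht : t ∈ Icc tThree 1) : IsNegativeType (cMatrix t) :=
  isNegativeType_fromBlocks _ (hFun_pos (pos_of_mem_Icc_tThree ht)) two_pos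
    (isTripleNegative_upperBlock ht) (by simp)

theorem analyticAt_upperBlock (ht : 0 < t) (i j : Fin 5) :
    AnalyticAt ℝ (fun t => upperBlock t i j) t := by
  have hratio : AnalyticAt ℝ gRatio t := by
    unfold gRatio
    exact AnalyticAt.div (by fun_prop) (by fun_prop) (by positivity)
  have hhigh : AnalyticAt ℝ highFactor t := by
    unfold highFactor
    exact AnalyticAt.div (by fun_prop) (by fun_prop) (by positivity)
  have hlow : AnalyticAt ℝ lowFactor t := by
    unfold lowFactor
    exact AnalyticAt.div (by fun_prop) (by fun_prop) (by positivity)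
  have hstep : AnalyticAt ℝ (fun t => stepMatrix (highFactor t) (lowFactor t) i j) t := by
    simp only [stepMatrix, Matrix.of_apply]
    split_ifs
    exacts [analyticAt_const, hhigh.neg, hlow.neg]
  refine (hstep.mul ((hratio.pow i).div (hratio.pow j) (pow_pos (gRatio_pos ht) _).ne')).congr ?_
  filter_upwards [lt_mem_nhds ht] with u hu
  rw [upperBlock_eq hu]
  rfl

theorem analyticAt_hFun (ht : 0 < t) : AnalyticAt ℝ hFun t := by
  unfold hFun
  exact (analyticAt_const.add (analyticAt_const.div analyticAt_id ht.ne')).add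
    (AnalyticAt.div (by fun_prop) (by fun_prop) (by positivity))

theorem analyticAt_lowerBlock (ht : 0 < t) (i j : Fin 5) :
    AnalyticAt ℝ (fun t => lowerBlock t i j) t := by
  simp only [lowerBlock_eq, stepMatrix, Matrix.of_apply]
  split_ifs
  exacts [analyticAt_const, (analyticAt_const.div analyticAt_id ht.ne').neg, analyticAt_id.neg]

theorem analyticAt_cMatrix (ht : 0 < t) (s s' : FacetIdx) :
    AnalyticAt ℝ (fun t => cMatrix t s s') t := by
  rcases s with i | i <;> rcases s' with j | j
  · exact analyticAt_upperBlock ht i j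
  · simp only [cMatrix_inl_inr]
    split_ifs
    exacts [(analyticAt_hFun ht).neg, analyticAt_const]
  · simp only [cMatrix_inr_inl]
    exact analyticAt_const
  · exact analyticAt_lowerBlock ht i j

end CartanMatrix

/-! ### The path of mirror polytopes -/

section MirrorVectors

variable {t : ℝ}

/-- The vectors `b_s`, in the coordinates in which the forms are `cutForm (upperBlock t)`. -/
def mirrorVec (t : ℝ) : FacetIdx → Vec 4 :=
  Sum.elim (fun j => Pi.single j 2) (fun j i => -lowerBlock t i j)

/-- The relation between the two diagonal blocks of `C_t` gives the block `C_{i'j}`. -/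
theorem cutForm_mirrorVec (ht : 0 < t) (s s' : FacetIdx) :
    cutForm (upperBlock t) s (mirrorVec t s') = cMatrix t s s' := by
  rcases s with i | i <;> rcases s' with j | j
  · rw [cutForm_inl, cMatrix_inl_inl, mirrorVec, Sum.elim_inl, Matrix.mulVec_single]
    simp only [Pi.smul_apply, Matrix.col_apply, MulOpposite.smul_eq_mul_unop, MulOpposite.unop_op]
    ring
  · have hcol : (mirrorVec t (Sum.inr j) : Fin 5 → ℝ) = -(lowerBlock t).col j := rfl
    have hmul := congrFun (congrFun (upperBlock_mul_lowerBlock ht) i) j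
    rw [Matrix.diagonal_apply] at hmul
    rw [cutForm_inl, cMatrix_inl_inr, hcol, Matrix.mulVec_neg, Pi.neg_apply]
    change 1 / 2 * -(upperBlock t * lowerBlock t) i j = _
    rw [hmul]
    split_ifs <;> ring
  · rw [cutForm_inr, cMatrix_inr_inl, mirrorVec, Sum.elim_inl, Pi.single_apply, neg_ite, neg_zero]
  · rw [cutForm_inr, cMatrix_inr_inr, mirrorVec, Sum.elim_inr, neg_neg]

theorem rank_dual_apply_le {K V S T : Type*} [Field K] [AddCommGroup V] [Module K V]
    [FiniteDimensional K V] [Fintype T] (φ : S → Module.Dual K V) (v : T → V) :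
    (Matrix.of fun s t => φ s (v t)).rank ≤ Module.finrank K V := by
  classical
  let e := Module.finBasis K V
  have hmul : (Matrix.of fun s t => φ s (v t)) =
      (Matrix.of fun s k => φ s (e k)) * Matrix.of fun k t => e.repr (v t) k := by
    ext s t
    conv_lhs => rw [Matrix.of_apply, ← e.sum_repr (v t), map_sum]
    simp only [Matrix.mul_apply, Matrix.of_apply, map_smul, smul_eq_mul, mul_comm]
  rw [hmul]
  calc _ ≤ (Matrix.of fun s k => φ s (e k)).rank := Matrix.rank_mul_le_left _ _
    _ ≤ Module.finrank K V := by
      simpa using (Matrix.of fun s k => φ s (e k)).rank_le_card_width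

theorem rank_cMatrix (ht : 0 < t) : (cMatrix t).rank = 5 := by
  refine le_antisymm ?_ ?_
  · have heq : cMatrix t = Matrix.of fun s s' => cutForm (upperBlock t) s (mirrorVec t s') :=
      Matrix.ext fun s s' => (cutForm_mirrorVec ht s s').symm
    rw [heq]
    simpa using rank_dual_apply_le (cutForm (upperBlock t)) (mirrorVec t)
  · have hdiag : (cMatrix t).submatrix Sum.inr Sum.inl =
        Matrix.diagonal fun _ : Fin 5 => (-2 : ℝ) := rfl
    have hunit : IsUnit (Matrix.diagonal fun _ : Fin 5 => (-2 : ℝ)) := by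
      simp [Matrix.isUnit_iff_isUnit_det]
    have hle := Matrix.rank_submatrix_le (cMatrix t) (Sum.inr : Fin 5 → FacetIdx) Sum.inl
    rwa [hdiag, Matrix.rank_of_isUnit _ hunit, Fintype.card_fin] at hle

end MirrorVectors

/-- The mirror polytope with Cartan matrix `C_t`. -/
def mirrorPolytope (t : Icc tThree 1) : MirrorPolytope 4 FacetIdx :=
  MirrorPolytope.ofCartan (cutForm (upperBlock t)) (mirrorVec t)
    (fun s => by rw [cutForm_mirrorVec (pos_of_mem_Icc_tThree t.2), cMatrix_self t.2])
    (fun s s' hs => by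
      simpa only [cutForm_mirrorVec (pos_of_mem_Icc_tThree t.2)] using cMatrix_neg_or_zero t.2 hs)
    (fun v hv => funext fun i => by simpa using hv (Sum.inr i))
    (((isTripleNegative_upperBlock t.2).exists_cutForm_neg (by simp)).imp fun y hy =>
      ⟨fun h0 => by simpa [h0] using hy (Sum.inr 0), hy⟩)

theorem mirrorPolytope_form (t : Icc tThree 1) :
    (mirrorPolytope t).form = cutForm (upperBlock t) := rfl

theorem mirrorPolytope_vec (t : Icc tThree 1) : (mirrorPolytope t).vec = mirrorVec t := rfl

theorem cartan_mirrorPolytope (t : Icc tThree 1) : (mirrorPolytope t).cartan = cMatrix t :=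
  Matrix.ext fun s s' => cutForm_mirrorVec (pos_of_mem_Icc_tThree t.2) s s'

theorem mirrorPolytope_form_vec (t : Icc tThree 1) (s s' : FacetIdx) :
    (mirrorPolytope t).form s ((mirrorPolytope t).vec s') = cMatrix t s s' :=
  cutForm_mirrorVec (pos_of_mem_Icc_tThree t.2) s s'

theorem continuous_mirrorPolytope : Continuous mirrorPolytope := by
  have hupper : ∀ i j, Continuous fun t : Icc tThree 1 => upperBlock t i j := fun i j =>
    continuous_iff_continuousAt.2 fun t => (analyticAt_upperBlock
      (pos_of_mem_Icc_tThree t.2) i j).continuousAt.comp continuousAt_subtype_val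
  have hlower : ∀ i j, Continuous fun t : Icc tThree 1 => lowerBlock t i j := fun i j =>
    continuous_iff_continuousAt.2 fun t => (analyticAt_lowerBlock
      (pos_of_mem_Icc_tThree t.2) i j).continuousAt.comp continuousAt_subtype_val
  rw [continuous_induced_rng]
  refine Continuous.prodMk (continuous_pi fun s => continuous_pi fun v => ?_)
    (continuous_pi fun s => ?_)
  · rcases s with i | i
    · simp only [mirrorPolytope_form, cutForm_inl, Matrix.mulVec, dotProduct]
      exact continuous_const.mul
        (continuous_finsetSum _ fun j _ => (hupper i j).mul continuous_const)
    · simp only [mirrorPolytope_form, cutForm_inr]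
      exact continuous_const
  · simp only [mirrorPolytope_vec]
    rcases s with j | j
    · exact continuous_const
    · exact continuous_pi fun i => (hlower i j).neg

theorem isIdealHyperbolicRectifiedSimplex_mirrorPolytope_one (h : (1 : ℝ) ∈ Icc tThree 1) :
    IsIdealHyperbolicRectifiedSimplex (mirrorPolytope ⟨1, h⟩) := by
  refine isIdealHyperbolicRectifiedSimplex_of_form_eq ?_ (fun j => rfl) fun j => funext fun i => ?_
  · rw [mirrorPolytope_form, upperBlock_eq one_pos]
    congr 1
    ext i j
    norm_num [simplexMatrix, highFactor, lowFactor, gRatio]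
  · rw [mirrorPolytope_vec, mirrorVec, Sum.elim_inr, lowerBlock_eq, Pi.sub_apply, Pi.one_apply,
      Pi.single_apply]
    split_ifs with hij
    · rw [hij, stepMatrix_self]
      norm_num
    · rw [stepMatrix_of_ne _ _ hij, one_div_one, ite_self, neg_neg, sub_zero]

theorem isBitruncatedActive_of_ncard_le_two {ι : Type*} [Finite ι] (hι : 5 ≤ Nat.card ι)
    {J : Set (ι ⊕ ι)} (hJ : J.ncard ≤ 2) (hdisj : Disjoint (Sum.inl ⁻¹' J) (Sum.inr ⁻¹' J)) :
    IsBitruncatedActive J := by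
  have hinl : (Sum.inl ⁻¹' J).ncard ≤ J.ncard := by
    rw [← ncard_image_of_injective _ Sum.inl_injective]
    exact ncard_le_ncard (image_preimage_subset _ _)
  have hinr : (Sum.inr ⁻¹' J).ncard ≤ J.ncard := by
    rw [← ncard_image_of_injective _ Sum.inr_injective]
    exact ncard_le_ncard (image_preimage_subset _ _)
  refine ⟨hdisj, hinl.trans hJ, ?_⟩
  rw [ncard_compl]
  omega

theorem MirrorPolytope.hasDihedralAngle {n : ℕ} {S : Type} [Finite S] (P : MirrorPolytope n S)
    {s t : S} (hst : s ≠ t) {y : Vec n} (hy0 : y ≠ 0) (hy : y ∈ polyhedron P.form 0)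
    (hact : activeSet P.form 0 y = {s, t}) {θ : ℝ} (hθ : θ ∈ Ioc 0 (π / 2))
    (h : P.form s (P.vec t) * P.form t (P.vec s) = 4 * cos θ ^ 2) : HasDihedralAngle P s t θ := by
  have hcos : cos θ ^ 2 < 1 := by
    have hsin : 0 < sin θ := sin_pos_of_pos_of_lt_pi hθ.1 (by linarith [hθ.2, pi_pos])
    nlinarith [sin_sq_add_cos_sq θ]
  have hzero : P.form s (P.vec t) = 0 ↔ P.form t (P.vec s) = 0 :=
    (P.neg_or_zero s t hst).elim (fun h => iff_of_false h.1.ne h.2.ne)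
      fun h => iff_of_true h.1 h.2
  exact ⟨P.isRidge_facet_inter hy0 hy hact (by linarith), Or.inl ⟨hθ.1, hθ.2,
    isProjRotation_reflection_comp (P.form_vec s) (P.form_vec t) hzero hθ.1
      (by linarith [hθ.2, pi_pos]) h⟩⟩

section Ridges

variable {t : Icc tThree 1}

theorem upperBlock_mul_lt_four (ht : 0 < angle t) (i j : Fin 5) (hij : i ≠ j) :
    upperBlock t i j * upperBlock t j i < 4 := by
  have ht₀ := pos_of_mem_Icc_tThree t.2
  have ht₁ : (t : ℝ) < 1 := by
    rwa [← angle_strictAntiOn.lt_iff_gt ⟨tThree_lt_one.le, le_rfl⟩ t.2, angle_one]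
  have hf := fFun_strictMonoOn ⟨ht₀, ht₁.le⟩ ⟨one_pos, le_rfl⟩ ht₁
  rw [fFun_one] at hf
  rw [upperBlock_mul_apply ht₀ hij]
  linarith

theorem isCombBitruncatedSimplex_mirrorPolytope (ht : 0 < angle t) :
    IsCombBitruncatedSimplex (mirrorPolytope t) :=
  isCombBitruncatedSimplex_of_form_eq rfl (isTripleNegative_upperBlock t.2)
    (upperBlock_mul_lt_four ht)

theorem hasDihedralAngle_mirrorPolytope (ht : 0 < angle t) {s s' : FacetIdx} (hs : s ≠ s')
    (hdisj : Disjoint (Sum.inl ⁻¹' {s, s'} : Set (Fin 5)) (Sum.inr ⁻¹' {s, s'})) {θ : ℝ}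
    (hθ : θ ∈ Ioc 0 (π / 2)) (h : cMatrix t s s' * cMatrix t s' s = 4 * cos θ ^ 2) :
    HasDihedralAngle (mirrorPolytope t) s s' θ := by
  have hJ : {s, s'} ∈ activeSet (cutForm (upperBlock t)) 0 ''
      (polyhedron (cutForm (upperBlock t)) 0 \ {0}) := by
    rw [(isTripleNegative_upperBlock t.2).image_activeSet_cutForm (upperBlock_mul_lt_four ht)]
    exact isBitruncatedActive_of_ncard_le_two (by simp) (ncard_pair hs).le hdisj
  obtain ⟨y, ⟨hy, hy0⟩, hact⟩ := hJ
  exact (mirrorPolytope t).hasDihedralAngle hs hy0 hy hact hθ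
    (by rwa [mirrorPolytope_form_vec, mirrorPolytope_form_vec])

theorem hasDihedralAngle_inl_inl (ht : 0 < angle t) {i j : Fin 5} (hij : i ≠ j) :
    HasDihedralAngle (mirrorPolytope t) (Sum.inl i) (Sum.inl j) (angle t) := by
  have hang := (angle_mem_Icc t.2).2
  refine hasDihedralAngle_mirrorPolytope ht (Sum.inl_injective.ne hij) ?_
    ⟨ht, by linarith [pi_pos]⟩ ?_
  · simp [preimage]
  · rw [cMatrix_inl_inl, cMatrix_inl_inl, upperBlock_mul_apply (pos_of_mem_Icc_tThree t.2) hij,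
      cos_angle_sq t.2]

theorem hasDihedralAngle_inr_inl (ht : 0 < angle t) {i j : Fin 5} (hij : i ≠ j) :
    HasDihedralAngle (mirrorPolytope t) (Sum.inr i) (Sum.inl j) (π / 2) := by
  refine hasDihedralAngle_mirrorPolytope ht Sum.inr_ne_inl ?_ ⟨by positivity, le_rfl⟩ ?_
  · simpa [preimage] using hij.symm
  · rw [cMatrix_inr_inl, if_neg hij, cos_pi_div_two]
    ring

theorem hasDihedralAngle_inr_inr (ht : 0 < angle t) {i j : Fin 5} (hij : i ≠ j) :
    HasDihedralAngle (mirrorPolytope t) (Sum.inr i) (Sum.inr j) (π / 3) := by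
  refine hasDihedralAngle_mirrorPolytope ht (Sum.inr_injective.ne hij) ?_
    ⟨by positivity, by linarith [pi_pos]⟩ ?_
  · simp [preimage]
  · rw [cMatrix_inr_inr, cMatrix_inr_inr,
      lowerBlock_mul_apply (pos_of_mem_Icc_tThree t.2).ne' hij, cos_pi_div_three]
    norm_num

end Ridges

end

theorem mainTheorem2 :
    (∀ t ∈ Set.Icc tThree 1,
      IsCartanMatrix (cMatrix t) ∧ IsIndecomposable (cMatrix t) ∧
        IsNegativeType (cMatrix t) ∧ (cMatrix t).rank = 5) ∧
    (∀ s s', AnalyticOn ℝ (fun t => cMatrix t s s') (Set.Icc tThree 1)) ∧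
    ∃ (a : ℝ → ℝ) (P : ℝ → MirrorPolytope 4 FacetIdx),
      -- the angle as a function of the parameter
      AnalyticOn ℝ a (Set.Icc tThree 1) ∧ StrictAntiOn a (Set.Icc tThree 1) ∧
      a tThree = Real.pi / 3 ∧ a 1 = 0 ∧
      (∀ t ∈ Set.Icc tThree 1, Real.cos (a t) ^ 2 = fFun t) ∧
      -- the path of mirror polytopes, including its limit at angle zero
      ContinuousOn P (Set.Icc 0 (Real.pi / 3)) ∧
      (∀ t ∈ Set.Icc tThree 1, (P (a t)).cartan = cMatrix t) ∧
      -- combinatorics and dihedral angles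
      (∀ α ∈ Set.Ioc 0 (Real.pi / 3),
        IsCombBitruncatedSimplex (P α) ∧
        ∀ i j : Fin 5, i ≠ j →
          HasDihedralAngle (P α) (Sum.inl i) (Sum.inl j) α ∧
          HasDihedralAngle (P α) (Sum.inr i) (Sum.inl j) (Real.pi / 2) ∧
          HasDihedralAngle (P α) (Sum.inr i) (Sum.inr j) (Real.pi / 3)) ∧
      -- the limit polytope
      IsIdealHyperbolicRectifiedSimplex (P 0) := by
  refine ⟨fun t ht => ⟨isCartanMatrix_cMatrix ht, isIndecomposable_cMatrix ht,
    isNegativeType_cMatrix ht, rank_cMatrix (pos_of_mem_Icc_tThree ht)⟩,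
    fun s s' t ht => (analyticAt_cMatrix (pos_of_mem_Icc_tThree ht) s s').analyticWithinAt,
    angle, fun α => mirrorPolytope (angleInv α),
    fun t ht => (analyticAt_angle ht).analyticWithinAt, angle_strictAntiOn, angle_tThree,
    angle_one, fun t ht => cos_angle_sq ht,
    (continuous_mirrorPolytope.comp continuous_angleInv).continuousOn, fun t ht => ?_,
    fun α hα => ?_, ?_⟩
  · dsimp only
    rw [angleInv_angle ⟨t, ht⟩, cartan_mirrorPolytope]
  · have hangle := angle_angleInv (Ioc_subset_Icc_self hα)
    have hpos : 0 < angle (angleInv α) := hangle.symm ▸ hα.1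
    exact ⟨isCombBitruncatedSimplex_mirrorPolytope hpos, fun i j hij =>
      ⟨by simpa only [hangle] using hasDihedralAngle_inl_inl hpos hij,
        hasDihedralAngle_inr_inl hpos hij, hasDihedralAngle_inr_inr hpos hij⟩⟩
  · have hone : (1 : ℝ) ∈ Icc tThree 1 := ⟨tThree_lt_one.le, le_rfl⟩
    dsimp only
    rw [← angle_one, angleInv_angle ⟨1, hone⟩]
    exact isIdealHyperbolicRectifiedSimplex_mirrorPolytope_one hone
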